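/- Let $\mathbb K=\mathbb R$ or $\mathbb C$, let $x=(x_1,\dots,x_n)$, let $\mathbb K\{x\}$ be the ring of convergent power series, and let $\mathfrak m$ be its maximal ideal. For an ideal $J\subset\mathbb K\{x\}$ let $H_J(\eta)=\dim_{\mathbb K}\mathbb K\{x\}/(J+\mathfrak m^{\eta+1})$, $\eta\in\mathbb N$, be its Hilbert-Samuel function. For $0\le k\le n$ let $(\tilde x)$ denote the ideal of $\mathbb K\{x\}$ generated by $x_{k+1},\dots,x_n$. For $F_1,\dots,F_s\in\mathbb K\{x\}$ and $\mu\in\mathbb N$ let $U^\mu(F_1,\dots,F_s)$ be the family of all ideals $(G_1,\dots,G_s)\cdot\mathbb K\{x\}$ such that $G_i\equiv F_i \pmod{\mathfrak m^{\mu+1}}$ for $i=1,\dots,s$. **Proposition.** Let $I=(F_1,\dots,F_s)$ be an ideal in $\mathbb K\{x\}$ with Krull dimension $\dim\mathbb K\{x\}/I=n-k$, where $0\le k\le n$. Then, after a generic linear change of coordinates in $\mathbb K^n$ (that is, for every invertible matrix $A$ outside the zero set of some nonzero polynomial in the $n^2$ matrix entries which depends only on $F_1,\dots,F_s$, after replacing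 each $F_i(x)$ by $F_i(Ax)$ and $I$ by the ideal generated by these series), there exists $\mu_0\in\mathbb N$ such that for every $\mu\ge\mu_0$ and every $I_\mu\in U^\mu(F_1,\dots,F_s)$ the following holds: if $$I_\mu\cap(\tilde x)=I_\mu\cdot(\tilde x)\quad\text{and}\quad \dim_{\mathbb K}\frac{\mathbb K\{x\}}{I+(\tilde x)^m}=\dim_{\mathbb K}\frac{\mathbb K\{x\}}{I_\mu+(\tilde x)^m}\ \text{ for all } m\ge1,$$ then $H_{I_\mu}(\eta)=H_I(\eta)$ for all $\eta\in\mathbb N$. -/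

import Mathlib

open scoped ENNReal NNReal

noncomputable section

namespace HSStability

section Convergent

variable {K : Type*} [RCLike K] {n : ℕ}

/-- A formal power series `∑ f_e x^e` is convergent if it converges absolutely on some polydisc
around the origin, i.e. `∑ ‖f_e‖ r^{|e|} < ∞` for some `r > 0`. -/
def IsConvergent (f : MvPowerSeries (Fin n) K) : Prop :=
  ∃ r : ℝ≥0, 0 < r ∧
    Summable fun e : Fin n →₀ ℕ => ‖MvPowerSeries.coeff e f‖₊ * r ^ Finsupp.degree e

/-- The (possibly infinite) majorant norm `∑ ‖f_e‖ r^{|e|}`. -/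
def wnorm (r : ℝ≥0) (f : MvPowerSeries (Fin n) K) : ℝ≥0∞ :=
  ∑' e : Fin n →₀ ℕ, ((‖MvPowerSeries.coeff e f‖₊ * r ^ Finsupp.degree e : ℝ≥0) : ℝ≥0∞)

theorem isConvergent_iff {f : MvPowerSeries (Fin n) K} :
    IsConvergent f ↔ ∃ r : ℝ≥0, 0 < r ∧ wnorm r f ≠ ∞ := by
  simp only [IsConvergent, wnorm, ENNReal.tsum_coe_ne_top_iff_summable]

theorem wnorm_mono {r s : ℝ≥0} (h : r ≤ s) (f : MvPowerSeries (Fin n) K) :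
    wnorm r f ≤ wnorm s f := by
  refine ENNReal.tsum_le_tsum fun e => ?_
  gcongr

theorem wnorm_add (r : ℝ≥0) (f g : MvPowerSeries (Fin n) K) :
    wnorm r (f + g) ≤ wnorm r f + wnorm r g := by
  unfold wnorm
  rw [← ENNReal.tsum_add]
  refine ENNReal.tsum_le_tsum fun e => ?_
  rw [← ENNReal.coe_add, ← add_mul, map_add]
  gcongr
  exact nnnorm_add_le _ _

theorem wnorm_monomial (r : ℝ≥0) (e : Fin n →₀ ℕ) (a : K) :
    wnorm r (MvPowerSeries.monomial e a) = ((‖a‖₊ * r ^ Finsupp.degree e : ℝ≥0) : ℝ≥0∞) := by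
  classical
  unfold wnorm
  rw [tsum_eq_single e]
  · simp
  · intro d hd
    simp [MvPowerSeries.coeff_monomial, hd]

theorem wnorm_C (r : ℝ≥0) (a : K) :
    wnorm r (MvPowerSeries.C a : MvPowerSeries (Fin n) K) = ‖a‖₊ := by
  rw [← MvPowerSeries.monomial_zero_eq_C_apply, wnorm_monomial]
  simp

theorem wnorm_mul (r : ℝ≥0) (f g : MvPowerSeries (Fin n) K) :
    wnorm r (f * g) ≤ wnorm r f * wnorm r g := by
  classical
  let F : (Fin n →₀ ℕ) × (Fin n →₀ ℕ) → ℝ≥0∞ := fun p =>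
    ((‖MvPowerSeries.coeff p.1 f‖₊ * r ^ Finsupp.degree p.1 : ℝ≥0) : ℝ≥0∞) *
      ((‖MvPowerSeries.coeff p.2 g‖₊ * r ^ Finsupp.degree p.2 : ℝ≥0) : ℝ≥0∞)
  have h1 : wnorm r f * wnorm r g = ∑' p, F p := by
    unfold wnorm
    rw [ENNReal.tsum_prod', ← ENNReal.tsum_mul_right]
    refine tsum_congr fun a => ?_
    rw [← ENNReal.tsum_mul_left]
  rw [h1, ← Finset.HasAntidiagonal.sigmaAntidiagonalEquivProd.tsum_eq, ENNReal.tsum_sigma']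
  refine ENNReal.tsum_le_tsum fun e => ?_
  rw [tsum_fintype, Finset.univ_eq_attach]
  simp only [Finset.HasAntidiagonal.sigmaAntidiagonalEquivProd_apply]
  rw [Finset.sum_attach (Finset.HasAntidiagonal.antidiagonal e) F, MvPowerSeries.coeff_mul]
  have h2 : ∀ p ∈ Finset.HasAntidiagonal.antidiagonal e, F p =
      ((‖MvPowerSeries.coeff p.1 f * MvPowerSeries.coeff p.2 g‖₊ *
        r ^ Finsupp.degree e : ℝ≥0) : ℝ≥0∞) := by
    intro p hp
    rw [Finset.HasAntidiagonal.mem_antidiagonal] at hp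
    simp only [F]
    rw [← hp, map_add, pow_add, nnnorm_mul, ← ENNReal.coe_mul]
    congr 1
    ring
  rw [Finset.sum_congr rfl h2, ← ENNReal.ofNNReal_finsetSum, ← Finset.sum_mul]
  gcongr
  exact nnnorm_sum_le _ _

theorem wnorm_pow (r : ℝ≥0) (f : MvPowerSeries (Fin n) K) (k : ℕ) :
    wnorm r (f ^ k) ≤ wnorm r f ^ k := by
  induction k with
  | zero =>
    rw [pow_zero, pow_zero, ← map_one (MvPowerSeries.C (σ := Fin n) (R := K)), wnorm_C]
    simp
  | succ k ih =>
    rw [pow_succ, pow_succ]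
    exact (wnorm_mul r _ _).trans (by gcongr)

theorem wnorm_prod (r : ℝ≥0) {ι : Type*} (s : Finset ι) (f : ι → MvPowerSeries (Fin n) K) :
    wnorm r (∏ i ∈ s, f i) ≤ ∏ i ∈ s, wnorm r (f i) := by
  classical
  induction s using Finset.induction_on with
  | empty => simpa using wnorm_pow r (0 : MvPowerSeries (Fin n) K) 0
  | insert a s ha ih =>
    rw [Finset.prod_insert ha, Finset.prod_insert ha]
    exact (wnorm_mul r _ _).trans (by gcongr)

theorem wnorm_sum (r : ℝ≥0) {ι : Type*} (s : Finset ι) (f : ι → MvPowerSeries (Fin n) K) :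
    wnorm r (∑ i ∈ s, f i) ≤ ∑ i ∈ s, wnorm r (f i) := by
  classical
  induction s using Finset.induction_on with
  | empty => simp [wnorm]
  | insert a s ha ih =>
    rw [Finset.sum_insert ha, Finset.sum_insert ha]
    exact (wnorm_add r _ _).trans (by gcongr)

/-- Series without constant term have small majorant norm on small polydiscs. -/
theorem wnorm_mul_radius {t r : ℝ≥0} (ht : t ≤ 1) {f : MvPowerSeries (Fin n) K}
    (hf : MvPowerSeries.constantCoeff f = 0) : wnorm (t * r) f ≤ t * wnorm r f := by
  unfold wnorm
  rw [← ENNReal.tsum_mul_left]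
  refine ENNReal.tsum_le_tsum fun e => ?_
  rw [← ENNReal.coe_mul]
  norm_cast
  by_cases he : e = 0
  · subst he
    simp [hf]
  · have hd : Finsupp.degree e ≠ 0 := by simpa [Finsupp.degree_eq_zero_iff] using he
    have : t ^ Finsupp.degree e ≤ t := pow_le_of_le_one (zero_le) ht hd
    calc ‖MvPowerSeries.coeff e f‖₊ * (t * r) ^ Finsupp.degree e
        = t ^ Finsupp.degree e * (‖MvPowerSeries.coeff e f‖₊ * r ^ Finsupp.degree e) := by
          rw [mul_pow]; ring
      _ ≤ _ := by gcongr

theorem IsConvergent.inv {f : MvPowerSeries (Fin n) K} (hf : IsConvergent f) :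
    IsConvergent f⁻¹ := by
  classical
  by_cases hc : MvPowerSeries.constantCoeff f = 0
  · rw [MvPowerSeries.inv_eq_zero.mpr hc]
    exact ⟨1, one_pos, by simp⟩
  obtain ⟨r, hr, hfr⟩ := isConvergent_iff.mp hf
  set c := MvPowerSeries.constantCoeff f with hcdef
  let h : MvPowerSeries (Fin n) K := 1 - MvPowerSeries.C c⁻¹ * f
  let g : MvPowerSeries (Fin n) K := MvPowerSeries.C c * f⁻¹
  have hh0 : MvPowerSeries.constantCoeff h = 0 := by
    simp [h, ← hcdef, hc]
  have hneg : wnorm r (MvPowerSeries.C (-1 : K) * (MvPowerSeries.C c⁻¹ * f)) ≠ ∞ := by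
    refine ne_top_of_le_ne_top ?_ (wnorm_mul r _ _)
    refine ENNReal.mul_ne_top (by rw [wnorm_C]; exact ENNReal.coe_ne_top) ?_
    refine ne_top_of_le_ne_top ?_ (wnorm_mul r _ _)
    exact ENNReal.mul_ne_top (by simp [wnorm_C]) hfr
  have hhr : wnorm r h ≠ ∞ := by
    have e1 : h = 1 + MvPowerSeries.C (-1) * (MvPowerSeries.C c⁻¹ * f) := by
      simp [h, sub_eq_add_neg]
    rw [e1]
    refine ne_top_of_le_ne_top ?_ (wnorm_add r _ _)
    refine ENNReal.add_ne_top.mpr ⟨?_, hneg⟩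
    rw [← map_one (MvPowerSeries.C (σ := Fin n) (R := K)), wnorm_C]
    simp
  obtain ⟨M, hM⟩ : ∃ M : ℝ≥0, (M : ℝ≥0∞) = wnorm r h := ⟨_, ENNReal.coe_toNNReal hhr⟩
  let t : ℝ≥0 := (2 * (M + 1))⁻¹
  have ht0 : 0 < t := by positivity
  have ht1 : t ≤ 1 := by
    refine inv_le_one_of_one_le₀ ?_
    calc (1 : ℝ≥0) ≤ 2 * 1 := by norm_num
      _ ≤ 2 * (M + 1) := by gcongr; simp
  have hsmall : wnorm (t * r) h ≤ ((2⁻¹ : ℝ≥0) : ℝ≥0∞) := by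
    refine (wnorm_mul_radius ht1 hh0).trans ?_
    rw [← hM, ← ENNReal.coe_mul, ENNReal.coe_le_coe]
    calc t * M ≤ t * (M + 1) := by gcongr; simp
      _ = 2⁻¹ := by simp only [t]; field_simp
  have hfi : f * f⁻¹ = 1 := MvPowerSeries.mul_inv_cancel f hc
  have hCC : (MvPowerSeries.C c⁻¹ : MvPowerSeries (Fin n) K) * MvPowerSeries.C c = 1 := by
    rw [← map_mul, inv_mul_cancel₀ hc, map_one]
  have hg1 : g = 1 + h * g := by
    have : (1 - h) * g = 1 := by
      simp only [h, g, sub_sub_cancel]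
      calc _ = (MvPowerSeries.C c⁻¹ * MvPowerSeries.C c) * (f * f⁻¹) := by ring
        _ = 1 := by rw [hCC, hfi, one_mul]
    linear_combination this
  have hgk : ∀ k : ℕ, g = ∑ j ∈ Finset.range k, h ^ j + h ^ k * g := by
    intro k
    induction k with
    | zero => simp
    | succ k ih =>
      rw [Finset.sum_range_succ, pow_succ]
      linear_combination ih + h ^ k * hg1
  have hcoef : ∀ e : Fin n →₀ ℕ, MvPowerSeries.coeff e g =
      ∑ j ∈ Finset.range (Finsupp.degree e + 1), MvPowerSeries.coeff e (h ^ j) := by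
    intro e
    have hz : MvPowerSeries.coeff e (h ^ (Finsupp.degree e + 1) * g) = 0 := by
      apply MvPowerSeries.coeff_of_lt_order
      have h1 : (1 : ℕ∞) ≤ h.order := by
        rw [Order.one_le_iff_pos, pos_iff_ne_zero]
        exact MvPowerSeries.order_ne_zero_iff_constCoeff_eq_zero.mpr hh0
      calc ((Finsupp.degree e : ℕ) : ℕ∞) < ((Finsupp.degree e + 1 : ℕ) : ℕ∞) := by
            exact_mod_cast Nat.lt_succ_self _
        _ = (Finsupp.degree e + 1) • (1 : ℕ∞) := by simp
        _ ≤ (Finsupp.degree e + 1) • h.order := by gcongr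
        _ ≤ (h ^ (Finsupp.degree e + 1)).order := MvPowerSeries.le_order_pow _
        _ ≤ (h ^ (Finsupp.degree e + 1)).order + g.order := le_self_add
        _ ≤ _ := MvPowerSeries.le_order_mul
    conv_lhs => rw [hgk (Finsupp.degree e + 1)]
    rw [map_add, hz, add_zero, map_sum]
  have hgn : wnorm (t * r) g ≠ ∞ := by
    have hle : wnorm (t * r) g ≤ ∑' j : ℕ, ((2⁻¹ : ℝ≥0) : ℝ≥0∞) ^ j := by
      calc wnorm (t * r) g ≤ ∑' e : Fin n →₀ ℕ, ∑' j : ℕ,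
            ((‖MvPowerSeries.coeff e (h ^ j)‖₊ * (t * r) ^ Finsupp.degree e : ℝ≥0) : ℝ≥0∞) := by
            refine ENNReal.tsum_le_tsum fun e => ?_
            rw [hcoef e]
            refine le_trans ?_ (ENNReal.sum_le_tsum (Finset.range (Finsupp.degree e + 1)))
            rw [← ENNReal.ofNNReal_finsetSum, ← Finset.sum_mul]
            gcongr
            exact nnnorm_sum_le _ _
        _ = ∑' j : ℕ, wnorm (t * r) (h ^ j) := ENNReal.tsum_comm
        _ ≤ _ := by
            refine ENNReal.tsum_le_tsum fun j => ?_
            exact (wnorm_pow _ _ _).trans (by gcongr)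
    refine ne_top_of_le_ne_top ?_ hle
    rw [ENNReal.tsum_geometric]
    rw [ENNReal.inv_ne_top]
    have : ((2⁻¹ : ℝ≥0) : ℝ≥0∞) < 1 := by
      rw [← ENNReal.coe_one, ENNReal.coe_lt_coe]
      exact inv_lt_one_of_one_lt₀ (by norm_num)
    exact (tsub_pos_of_lt this).ne'
  refine isConvergent_iff.mpr ⟨t * r, mul_pos ht0 hr, ?_⟩
  have e2 : f⁻¹ = MvPowerSeries.C c⁻¹ * g := by
    simp only [g]
    rw [← mul_assoc, hCC, one_mul]
  rw [e2]
  refine ne_top_of_le_ne_top ?_ (wnorm_mul _ _ _)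
  exact ENNReal.mul_ne_top (by simp [wnorm_C]) hgn

end Convergent

section Ring

variable (K : Type*) [RCLike K] (n : ℕ)

/-- The convergent power series form a `K`-subalgebra of the formal power series. -/
def convergentSubalgebra : Subalgebra K (MvPowerSeries (Fin n) K) where
  carrier := {f | IsConvergent f}
  mul_mem' := by
    intro f g hf hg
    obtain ⟨r, hr, hf⟩ := isConvergent_iff.mp hf
    obtain ⟨s, hs, hg⟩ := isConvergent_iff.mp hg
    refine isConvergent_iff.mpr ⟨min r s, lt_min hr hs, ?_⟩
    refine ne_top_of_le_ne_top ?_ (wnorm_mul _ _ _)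
    exact ENNReal.mul_ne_top (ne_top_of_le_ne_top hf (wnorm_mono (min_le_left _ _) _))
      (ne_top_of_le_ne_top hg (wnorm_mono (min_le_right _ _) _))
  add_mem' := by
    intro f g hf hg
    obtain ⟨r, hr, hf⟩ := isConvergent_iff.mp hf
    obtain ⟨s, hs, hg⟩ := isConvergent_iff.mp hg
    refine isConvergent_iff.mpr ⟨min r s, lt_min hr hs, ?_⟩
    refine ne_top_of_le_ne_top ?_ (wnorm_add _ _ _)
    exact ENNReal.add_ne_top.mpr ⟨ne_top_of_le_ne_top hf (wnorm_mono (min_le_left _ _) _),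
      ne_top_of_le_ne_top hg (wnorm_mono (min_le_right _ _) _)⟩
  algebraMap_mem' := by
    intro a
    refine isConvergent_iff.mpr ⟨1, one_pos, ?_⟩
    rw [MvPowerSeries.algebraMap_apply, wnorm_C]
    simp

/-- The ring `K{x} = K{x₁, …, xₙ}` of convergent power series in `n` variables. -/
abbrev ConvPS : Type _ := convergentSubalgebra K n

variable {K n}

/-- The coordinate function `xᵢ` as a convergent power series. -/
def coord (i : Fin n) : ConvPS K n :=
  ⟨MvPowerSeries.X i, isConvergent_iff.mpr ⟨1, one_pos, by
    rw [MvPowerSeries.X, wnorm_monomial]; simp⟩⟩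

/-- `K{x}` is a local ring. -/
instance : IsLocalRing (ConvPS K n) := by
  have key : ∀ f : ConvPS K n, MvPowerSeries.constantCoeff f.1 ≠ 0 → IsUnit f := fun f hf =>
    IsUnit.of_mul_eq_one ⟨f.1⁻¹, IsConvergent.inv f.2⟩
      (Subtype.ext (MvPowerSeries.mul_inv_cancel f.1 hf))
  refine IsLocalRing.of_isUnit_or_isUnit_one_sub_self fun f => ?_
  by_cases hf : MvPowerSeries.constantCoeff f.1 = 0
  · right
    apply key
    simp [hf]
  · left
    exact key f hf

/-- The linear forms `∑ⱼ Aᵢⱼ xⱼ`, i.e. the components of `x ↦ A x`. -/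
def linForm (A : Matrix (Fin n) (Fin n) K) (i : Fin n) : MvPowerSeries (Fin n) K :=
  ∑ j, MvPowerSeries.C (A i j) * MvPowerSeries.X j

theorem hasSubst_linForm (A : Matrix (Fin n) (Fin n) K) :
    MvPowerSeries.HasSubst (linForm A) :=
  MvPowerSeries.hasSubst_of_constantCoeff_zero fun i => by simp [linForm]

theorem IsConvergent.subst_linForm (A : Matrix (Fin n) (Fin n) K)
    {f : MvPowerSeries (Fin n) K} (hf : IsConvergent f) :
    IsConvergent (f.subst (linForm A)) := by
  obtain ⟨r, hr, hfr⟩ := isConvergent_iff.mp hf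
  let M : ℝ≥0 := ∑ i, ∑ j, ‖A i j‖₊ + 1
  have hM : 0 < M := by positivity
  have hlin : ∀ i, wnorm (r / M) (linForm A i) ≤ (r : ℝ≥0∞) := by
    intro i
    calc wnorm (r / M) (linForm A i)
        ≤ ∑ j, wnorm (r / M) (MvPowerSeries.C (A i j) * MvPowerSeries.X j) := wnorm_sum _ _ _
      _ ≤ ∑ j, ((‖A i j‖₊ * (r / M) : ℝ≥0) : ℝ≥0∞) := by
          refine Finset.sum_le_sum fun j _ => ?_
          refine (wnorm_mul _ _ _).trans ?_
          rw [wnorm_C, MvPowerSeries.X, wnorm_monomial]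
          simp
      _ = (((∑ j, ‖A i j‖₊) * (r / M) : ℝ≥0) : ℝ≥0∞) := by
          rw [← ENNReal.ofNNReal_finsetSum, Finset.sum_mul]
      _ ≤ ((M * (r / M) : ℝ≥0) : ℝ≥0∞) := by
          have h1 : ∑ j, ‖A i j‖₊ ≤ ∑ i, ∑ j, ‖A i j‖₊ :=
            Finset.single_le_sum (f := fun i => ∑ j, ‖A i j‖₊) (fun _ _ => zero_le)
              (Finset.mem_univ i)
          have h2 : ∑ j, ‖A i j‖₊ ≤ M := h1.trans le_self_add
          gcongr
      _ = r := by rw [mul_div_cancel₀ _ hM.ne']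
  refine isConvergent_iff.mpr ⟨r / M, div_pos hr hM, ?_⟩
  refine ne_top_of_le_ne_top hfr ?_
  calc wnorm (r / M) (f.subst (linForm A))
      ≤ ∑' e : Fin n →₀ ℕ, ∑' d : Fin n →₀ ℕ, ((‖MvPowerSeries.coeff d f‖₊ *
          (‖MvPowerSeries.coeff e (d.prod fun s k => linForm A s ^ k)‖₊ *
            (r / M) ^ Finsupp.degree e) : ℝ≥0) : ℝ≥0∞) := by
        refine ENNReal.tsum_le_tsum fun e => ?_
        rw [MvPowerSeries.coeff_subst (hasSubst_linForm A), finsum_eq_sum _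
          (MvPowerSeries.coeff_subst_finite (hasSubst_linForm A) f e)]
        refine le_trans ?_ (ENNReal.sum_le_tsum
          (MvPowerSeries.coeff_subst_finite (hasSubst_linForm A) f e).toFinset)
        rw [← ENNReal.ofNNReal_finsetSum, ENNReal.coe_le_coe]
        simp only [← mul_assoc]
        rw [← Finset.sum_mul]
        gcongr
        refine (nnnorm_sum_le _ _).trans (le_of_eq ?_)
        refine Finset.sum_congr rfl fun d _ => ?_
        rw [smul_eq_mul, nnnorm_mul]
    _ = ∑' d : Fin n →₀ ℕ, (‖MvPowerSeries.coeff d f‖₊ : ℝ≥0∞) *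
          wnorm (r / M) (d.prod fun s k => linForm A s ^ k) := by
        rw [ENNReal.tsum_comm]
        refine tsum_congr fun d => ?_
        rw [wnorm, ← ENNReal.tsum_mul_left]
        refine tsum_congr fun e => ?_
        rw [ENNReal.coe_mul]
    _ ≤ wnorm r f := by
        refine ENNReal.tsum_le_tsum fun d => ?_
        rw [ENNReal.coe_mul]
        gcongr
        rw [Finsupp.prod]
        refine (wnorm_prod _ _ _).trans ?_
        rw [Finsupp.degree_apply, ← Finset.prod_pow_eq_pow_sum, ENNReal.ofNNReal_finsetProd]
        refine Finset.prod_le_prod' fun i _ => (wnorm_pow _ _ _).trans ?_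
        rw [ENNReal.coe_pow]
        gcongr
        exact hlin i

/-- The linear substitution `F(x) ↦ F(A x)` on `K{x}`. For invertible `A` this is a linear change
of coordinates in `Kⁿ`. -/
def linChange (A : Matrix (Fin n) (Fin n) K) : ConvPS K n →ₐ[K] ConvPS K n :=
  ((MvPowerSeries.substAlgHom (hasSubst_linForm A)).comp
    (convergentSubalgebra K n).val).codRestrict (convergentSubalgebra K n) fun f => by
      have h := IsConvergent.subst_linForm A f.2
      rw [← MvPowerSeries.coe_substAlgHom (hasSubst_linForm A)] at h
      exact h

/-- `p` holds for a generic linear change of coordinates: there is a nonzero polynomial `P` in the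
entries of an `n × n` matrix such that `p A` holds for every invertible `A` with `P(A) ≠ 0`, i.e.
`p` holds on a nonempty Zariski open subset of `GLₙ(K)`. -/
def ForGenericLinearChange (p : GL (Fin n) K → Prop) : Prop :=
  ∃ P : MvPolynomial (Fin n × Fin n) K, P ≠ 0 ∧
    ∀ A : GL (Fin n) K, MvPolynomial.eval (fun ij => A.val ij.1 ij.2) P ≠ 0 → p A

/-- The ideal `(x_{k+1}, …, x_n)` of `K{x}`, generated by all but the first `k` variables. -/
def tailIdeal (K : Type*) [RCLike K] (n k : ℕ) : Ideal (ConvPS K n) :=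
  Ideal.span {f | ∃ i : Fin n, k ≤ i.val ∧ f = coord i}

/-- The `μ`-jet of `F`: its image in `K{x} / 𝔪^{μ+1}`. -/
def jet (μ : ℕ) (F : ConvPS K n) :
    ConvPS K n ⧸ IsLocalRing.maximalIdeal (ConvPS K n) ^ (μ + 1) :=
  Ideal.Quotient.mk _ F

/-- The family `U^μ(F₁, …, F_s)` of the `μ`-jet approximations of the ideal `(F₁, …, F_s)`: all
ideals `(G₁, …, G_s)` with `j^μ Gᵢ = j^μ Fᵢ` for all `i`. -/
def jetApprox {s : ℕ} (μ : ℕ) (F : Fin s → ConvPS K n) : Set (Ideal (ConvPS K n)) :=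
  {J | ∃ G : Fin s → ConvPS K n, (∀ i, jet μ (G i) = jet μ (F i)) ∧ J = Ideal.span (Set.range G)}

/-- The Hilbert-Samuel function `H_I(η) = dim_K K{x} / (I + 𝔪^{η+1})`; these spaces are
finite-dimensional, being quotients of the space of polynomials of degree at most `η`. -/
def hilbertSamuel (I : Ideal (ConvPS K n)) (η : ℕ) : ℕ :=
  Module.finrank K (ConvPS K n ⧸ (I ⊔ IsLocalRing.maximalIdeal (ConvPS K n) ^ (η + 1)))

end Ring

end HSStability

end

/-!
The hypothesis `I_μ ∩ (x̃) = I_μ · (x̃)` says that `K{x}/I_μ` is flat over the variables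
`x̃ = (x_{k+1}, …, x_n)`, and the equality of the dimensions of the quotients by `(x̃)^m` transfers
this to `K{x}/I`. For generic coordinates `(x̃)` is moreover a reduction of the maximal ideal `𝔪` of
`K{x}/I`, that is `𝔪^{c+1} ⊆ I + (x̃) 𝔪^c` for some `c`, and by Nakayama's lemma the same holds for
`I_μ` once `μ > c`. Put `J = I + 𝔪^c = I_μ + 𝔪^c`; then `I + 𝔪^{c+j} = I + (x̃)^j J`, and likewise for
`I_μ`. Let `B` be a vector space complement of `I + (x̃) = I_μ + (x̃)`. By flatness, for
`L = c + j`, the space of the polynomials of degree less than `L` in `x̃` with coefficients in `B` is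
a complement both of `I + (x̃)^L` and of `I_μ + (x̃)^L`. The trace of `I + (x̃)^j J` on this space is
`∑_{|ν| = j} x̃^ν (U_c ∩ J)`, where `U_c` consists of the polynomials of degree less than `c`. This
depends only on `B` and `J`, so that the quotients by `I + 𝔪^{c+j}` and `I_μ + 𝔪^{c+j}` have the same
dimension; for exponents up to `c` the ideals themselves agree. This is
`hilbertSamuel_eq_of_reduction`.

It remains to see that `(x̃)` is a reduction in generic coordinates. This is a maximal rank condition,
hence Zariski open (`exists_polynomial_of_reduction_map`), so that one choice of coordinates is
enough (`exists_reduction`). It is found as in Noether normalization, dropping one variable at a time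
from the reduction `(x_1, …, x_n)` of `𝔪`. If `(x_{j+1}, …, x_n)` is a reduction, then `K{x}/I` is
finite over the ring `S` of power series in these variables, by a Weierstrass division argument
(`finite_tailAlgebra`). If `S` embeds in `K{x}/I`, then going up along the chain of the primes
`(x_{j+1}, …, x_l)` of `S` gives `dim K{x}/I ≥ n - j`, hence `j ≥ k`. Otherwise there is a nonzero
series in `S ∩ I`; after a linear change of coordinates its leading form is regular in `x_{j+1}`, and
`x_{j+1}` can be dropped (`exists_reduction_succ`).
-/

noncomputable section

namespace HSStability

/-! ### Division by monomials and weighted majorant norms -/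

section DivPart

variable {K : Type*} [RCLike K] {n : ℕ}

open scoped Classical in
/-- The quotient by the monomial `x^β` of the part of `f` supported on the set `E` of exponents:
`∑_{e ∈ E, β ≤ e} f_e x^{e-β}`. -/
def divPart (β : Fin n →₀ ℕ) (E : Set (Fin n →₀ ℕ)) :
    MvPowerSeries (Fin n) K →ₗ[K] MvPowerSeries (Fin n) K where
  toFun f := fun d => if d + β ∈ E then MvPowerSeries.coeff (d + β) f else 0
  map_add' f g := by
    ext d
    change (if d + β ∈ E then MvPowerSeries.coeff (d + β) (f + g) else 0) =
      (if d + β ∈ E then MvPowerSeries.coeff (d + β) f else 0) +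
        (if d + β ∈ E then MvPowerSeries.coeff (d + β) g else 0)
    split_ifs <;> simp
  map_smul' a f := by
    ext d
    change (if d + β ∈ E then MvPowerSeries.coeff (d + β) (a • f) else 0) =
      a * (if d + β ∈ E then MvPowerSeries.coeff (d + β) f else 0)
    split_ifs <;> simp

open scoped Classical in
theorem coeff_divPart (β : Fin n →₀ ℕ) (E : Set (Fin n →₀ ℕ)) (f : MvPowerSeries (Fin n) K)
    (d : Fin n →₀ ℕ) : MvPowerSeries.coeff d (divPart β E f) =
      if d + β ∈ E then MvPowerSeries.coeff (d + β) f else 0 := rfl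

open scoped Classical in
theorem coeff_monomial_mul_divPart {β : Fin n →₀ ℕ} {E : Set (Fin n →₀ ℕ)}
    (hE : ∀ e ∈ E, β ≤ e) (f : MvPowerSeries (Fin n) K) (e : Fin n →₀ ℕ) :
    MvPowerSeries.coeff e (MvPowerSeries.monomial β (1 : K) * divPart β E f) =
      if e ∈ E then MvPowerSeries.coeff e f else 0 := by
  rw [MvPowerSeries.coeff_monomial_mul, coeff_divPart]
  by_cases h : β ≤ e
  · simp [h, tsub_add_cancel_of_le h]
  · have : e ∉ E := fun he => h (hE e he)
    simp [h, this]

/-- Sorting the exponents of `f` by a partial choice `pick` of a monomial `x^{β i}` dividing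
them writes `f` as a combination of the `x^{β i}` up to the terms without a choice. -/
theorem eq_sum_monomial_mul_divPart {ι : Type*} [Fintype ι] (β : ι → Fin n →₀ ℕ)
    (pick : (Fin n →₀ ℕ) → Option ι) (hp : ∀ e i, pick e = some i → β i ≤ e)
    (f : MvPowerSeries (Fin n) K) :
    f = ∑ i, MvPowerSeries.monomial (β i) (1 : K) * divPart (β i) {e | pick e = some i} f +
      divPart 0 {e | pick e = none} f := by
  classical
  ext e
  rw [map_add, map_sum, Finset.sum_congr rfl fun i _ =>
    coeff_monomial_mul_divPart (E := {e | pick e = some i}) (fun e he => hp e i he) f e]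
  simp only [coeff_divPart, Set.mem_ofPred_eq, add_zero]
  obtain h | ⟨i, h⟩ := Option.eq_none_or_eq_some (pick e) <;> simp [h]

/-- The weighted majorant norm `∑ ‖f_e‖ w^e` on the polydisc of polyradius `w`. -/
def polyNorm (w : Fin n → ℝ≥0) (f : MvPowerSeries (Fin n) K) : ℝ≥0∞ :=
  ∑' e : Fin n →₀ ℕ, ((‖MvPowerSeries.coeff e f‖₊ * ∏ i, w i ^ e i : ℝ≥0) : ℝ≥0∞)

theorem polyNorm_const (r : ℝ≥0) (f : MvPowerSeries (Fin n) K) :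
    polyNorm (fun _ => r) f = wnorm r f := by
  simp only [polyNorm, wnorm, Finset.prod_pow_eq_pow_sum, Finsupp.degree_eq_sum]

theorem polyNorm_mono {v w : Fin n → ℝ≥0} (h : v ≤ w) (f : MvPowerSeries (Fin n) K) :
    polyNorm v f ≤ polyNorm w f := by
  refine ENNReal.tsum_le_tsum fun e => ?_
  gcongr with i
  exact h i

theorem polyNorm_add (w : Fin n → ℝ≥0) (f g : MvPowerSeries (Fin n) K) :
    polyNorm w (f + g) ≤ polyNorm w f + polyNorm w g := by
  unfold polyNorm
  rw [← ENNReal.tsum_add]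
  refine ENNReal.tsum_le_tsum fun e => ?_
  rw [← ENNReal.coe_add, ← add_mul, map_add]
  gcongr
  exact nnnorm_add_le _ _

theorem polyNorm_zero (w : Fin n → ℝ≥0) : polyNorm w (0 : MvPowerSeries (Fin n) K) = 0 := by
  simp [polyNorm]

theorem polyNorm_sum (w : Fin n → ℝ≥0) {ι : Type*} (s : Finset ι)
    (f : ι → MvPowerSeries (Fin n) K) :
    polyNorm w (∑ i ∈ s, f i) ≤ ∑ i ∈ s, polyNorm w (f i) := by
  classical
  induction s using Finset.induction_on with
  | empty => simp [polyNorm_zero]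
  | insert a s ha ih =>
    rw [Finset.sum_insert ha, Finset.sum_insert ha]
    exact (polyNorm_add w _ _).trans (by gcongr)

theorem polyNorm_mul (w : Fin n → ℝ≥0) (f g : MvPowerSeries (Fin n) K) :
    polyNorm w (f * g) ≤ polyNorm w f * polyNorm w g := by
  classical
  let F : (Fin n →₀ ℕ) × (Fin n →₀ ℕ) → ℝ≥0∞ := fun p =>
    ((‖MvPowerSeries.coeff p.1 f‖₊ * ∏ i, w i ^ p.1 i : ℝ≥0) : ℝ≥0∞) *
      ((‖MvPowerSeries.coeff p.2 g‖₊ * ∏ i, w i ^ p.2 i : ℝ≥0) : ℝ≥0∞)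
  have h1 : polyNorm w f * polyNorm w g = ∑' p, F p := by
    unfold polyNorm
    rw [ENNReal.tsum_prod', ← ENNReal.tsum_mul_right]
    refine tsum_congr fun a => ?_
    rw [← ENNReal.tsum_mul_left]
  rw [h1, ← Finset.HasAntidiagonal.sigmaAntidiagonalEquivProd.tsum_eq, ENNReal.tsum_sigma']
  refine ENNReal.tsum_le_tsum fun e => ?_
  rw [tsum_fintype, Finset.univ_eq_attach]
  simp only [Finset.HasAntidiagonal.sigmaAntidiagonalEquivProd_apply]
  rw [Finset.sum_attach (Finset.HasAntidiagonal.antidiagonal e) F, MvPowerSeries.coeff_mul]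
  have h2 : ∀ p ∈ Finset.HasAntidiagonal.antidiagonal e, F p =
      ((‖MvPowerSeries.coeff p.1 f * MvPowerSeries.coeff p.2 g‖₊ *
        ∏ i, w i ^ e i : ℝ≥0) : ℝ≥0∞) := by
    intro p hp
    rw [Finset.HasAntidiagonal.mem_antidiagonal] at hp
    simp only [F]
    rw [← hp, nnnorm_mul, ← ENNReal.coe_mul]
    simp only [Finsupp.add_apply, pow_add, Finset.prod_mul_distrib]
    congr 1
    ring
  rw [Finset.sum_congr rfl h2, ← ENNReal.ofNNReal_finsetSum, ← Finset.sum_mul]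
  gcongr
  exact nnnorm_sum_le _ _

theorem IsConvergent.of_polyNorm {w : Fin n → ℝ≥0} (hw : ∀ i, 0 < w i)
    {f : MvPowerSeries (Fin n) K} (hf : polyNorm w f ≠ ∞) : IsConvergent f := by
  obtain ⟨r, hr, hrw⟩ : ∃ r : ℝ≥0, 0 < r ∧ ∀ i, r ≤ w i := by
    by_cases hn : Nonempty (Fin n)
    · obtain ⟨i, hi⟩ := Finite.exists_min w
      exact ⟨w i, hw i, hi⟩
    · exact ⟨1, one_pos, fun i => (hn ⟨i⟩).elim⟩
  refine isConvergent_iff.mpr ⟨r, hr, ?_⟩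
  rw [← polyNorm_const]
  exact ne_top_of_le_ne_top hf (polyNorm_mono (fun i => hrw i) f)

theorem polyNorm_divPart (w : Fin n → ℝ≥0) (β : Fin n →₀ ℕ) (E : Set (Fin n →₀ ℕ))
    (f : MvPowerSeries (Fin n) K) :
    ((∏ i, w i ^ β i : ℝ≥0) : ℝ≥0∞) * polyNorm w (divPart β E f) ≤ polyNorm w f := by
  classical
  unfold polyNorm
  rw [← ENNReal.tsum_mul_left]
  refine le_trans (ENNReal.tsum_le_tsum fun d => ?_)
    (ENNReal.tsum_comp_le_tsum_of_injective (f := fun d : Fin n →₀ ℕ => d + β)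
      (add_left_injective β) _)
  rw [← ENNReal.coe_mul, ENNReal.coe_le_coe, coeff_divPart]
  split_ifs
  · simp only [Finsupp.add_apply, pow_add, Finset.prod_mul_distrib]
    apply le_of_eq; ring
  · simp

theorem IsConvergent.divPart {f : MvPowerSeries (Fin n) K} (hf : IsConvergent f)
    (β : Fin n →₀ ℕ) (E : Set (Fin n →₀ ℕ)) : IsConvergent (divPart β E f) := by
  obtain ⟨r, hr, hf⟩ := isConvergent_iff.mp hf
  rw [← polyNorm_const] at hf
  refine IsConvergent.of_polyNorm (w := fun _ => r) (fun _ => hr) fun h => hf ?_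
  have := polyNorm_divPart (fun _ => r) β E f
  rw [h, ENNReal.mul_top (by positivity)] at this
  exact top_le_iff.mp this

/-- `divPart` on convergent power series. -/
def cdivPart (β : Fin n →₀ ℕ) (E : Set (Fin n →₀ ℕ)) : ConvPS K n →ₗ[K] ConvPS K n where
  toFun f := ⟨divPart β E f.1, IsConvergent.divPart f.2 β E⟩
  map_add' f g := Subtype.ext (map_add (divPart β E) f.1 g.1)
  map_smul' a f := Subtype.ext (map_smul (divPart β E) a f.1)

theorem coe_cdivPart (β : Fin n →₀ ℕ) (E : Set (Fin n →₀ ℕ)) (f : ConvPS K n) :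
    (cdivPart β E f).1 = divPart β E f.1 := rfl

/-- The monomial `x^β` as a convergent power series. -/
def mon (K : Type*) [RCLike K] {n : ℕ} (β : Fin n →₀ ℕ) : ConvPS K n :=
  ⟨MvPowerSeries.monomial β (1 : K), isConvergent_iff.mpr ⟨1, one_pos, by simp [wnorm_monomial]⟩⟩

theorem mon_zero : mon K (0 : Fin n →₀ ℕ) = 1 := rfl

theorem mon_add (α β : Fin n →₀ ℕ) : mon K (α + β) = mon K α * mon K β := by
  apply Subtype.ext
  simp [mon, MvPowerSeries.monomial_mul_monomial]

theorem mon_single_one (i : Fin n) : mon K (Finsupp.single i 1) = coord i := rfl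

theorem mon_single (i : Fin n) (p : ℕ) : mon K (Finsupp.single i p) = coord i ^ p := by
  induction p with
  | zero => simp [mon_zero]
  | succ p ih => rw [Finsupp.single_add, mon_add, ih, mon_single_one, pow_succ]

theorem ConvPS.eq_sum {ι : Type*} [Fintype ι] (β : ι → Fin n →₀ ℕ)
    (pick : (Fin n →₀ ℕ) → Option ι) (hp : ∀ e i, pick e = some i → β i ≤ e)
    (f : ConvPS K n) :
    f = ∑ i, mon K (β i) * cdivPart (β i) {e | pick e = some i} f +
      cdivPart 0 {e | pick e = none} f := by
  apply Subtype.ext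
  rw [Subalgebra.coe_add, AddSubmonoidClass.coe_finsetSum]
  exact eq_sum_monomial_mul_divPart β pick hp f.1

end DivPart

/-! ### The ideals generated by a tail of the variables -/

section TailDegree

variable {K : Type*} [RCLike K] {n : ℕ}

/-- The degree of the exponent `e` in the variables `x_{k+1}, …, x_n`. -/
def tailDeg (k : ℕ) (e : Fin n →₀ ℕ) : ℕ := ∑ i : Fin n, if k ≤ i.val then e i else 0

theorem tailDeg_add (k : ℕ) (d e : Fin n →₀ ℕ) :
    tailDeg k (d + e) = tailDeg k d + tailDeg k e := by
  simp only [tailDeg, ← Finset.sum_add_distrib]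
  refine Finset.sum_congr rfl fun i _ => ?_
  split_ifs <;> simp

theorem tailDeg_single {k : ℕ} {i : Fin n} (hi : k ≤ i.val) (p : ℕ) :
    tailDeg k (Finsupp.single i p) = p := by
  classical
  rw [tailDeg, Finset.sum_eq_single i]
  · simp [hi]
  · intro j _ hj
    simp [hj.symm]
  · simp

theorem tailDeg_eq_zero {k : ℕ} {e : Fin n →₀ ℕ} :
    tailDeg k e = 0 ↔ ∀ i : Fin n, k ≤ i.val → e i = 0 := by
  simp [tailDeg, Finset.sum_eq_zero_iff]

theorem tailDeg_zero_left (e : Fin n →₀ ℕ) : tailDeg 0 e = Finsupp.degree e := by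
  simp [tailDeg, Finsupp.degree_eq_sum]

theorem tailDeg_mono (k : ℕ) {d e : Fin n →₀ ℕ} (h : d ≤ e) : tailDeg k d ≤ tailDeg k e := by
  obtain ⟨c, rfl⟩ := exists_add_of_le h
  rw [tailDeg_add]; omega

/-- The ideal of the series all of whose terms have degree at least `m` in the variables
`x_{k+1}, …, x_n`. -/
def tailOrderIdeal (K : Type*) [RCLike K] (n k m : ℕ) : Ideal (ConvPS K n) where
  carrier := {f | ∀ e, tailDeg k e < m → MvPowerSeries.coeff e f.1 = 0}
  add_mem' {f g} hf hg e he := by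
    simp [hf e he, hg e he]
  zero_mem' e _ := by simp
  smul_mem' c f hf e he := by
    classical
    rw [smul_eq_mul, Subalgebra.coe_mul, MvPowerSeries.coeff_mul]
    refine Finset.sum_eq_zero fun p hp => ?_
    rw [Finset.HasAntidiagonal.mem_antidiagonal] at hp
    rw [hf p.2 (lt_of_le_of_lt (tailDeg_mono k (by simp [← hp])) he), mul_zero]

theorem mem_tailOrderIdeal {k m : ℕ} {f : ConvPS K n} :
    f ∈ tailOrderIdeal K n k m ↔ ∀ e, tailDeg k e < m → MvPowerSeries.coeff e f.1 = 0 := Iff.rfl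

theorem tailOrderIdeal_mul_le (k a b : ℕ) :
    tailOrderIdeal K n k a * tailOrderIdeal K n k b ≤ tailOrderIdeal K n k (a + b) := by
  classical
  rw [Ideal.mul_le]
  intro f hf g hg e he
  rw [Subalgebra.coe_mul, MvPowerSeries.coeff_mul]
  refine Finset.sum_eq_zero fun p hp => ?_
  rw [Finset.HasAntidiagonal.mem_antidiagonal] at hp
  rw [← hp, tailDeg_add] at he
  by_cases h : tailDeg k p.1 < a
  · rw [hf _ h, zero_mul]
  · rw [hg p.2 (by omega), mul_zero]

theorem mon_mem_tailOrderIdeal (k : ℕ) (β : Fin n →₀ ℕ) :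
    mon K β ∈ tailOrderIdeal K n k (tailDeg k β) := by
  classical
  intro e he
  have : e ≠ β := by rintro rfl; exact lt_irrefl _ he
  simp [mon, MvPowerSeries.coeff_monomial, this]

theorem coord_mem_tailIdeal {k : ℕ} {i : Fin n} (hi : k ≤ i.val) :
    (coord i : ConvPS K n) ∈ tailIdeal K n k := Ideal.subset_span ⟨i, hi, rfl⟩

theorem tailOrderIdeal_zero (k : ℕ) : tailOrderIdeal K n k 0 = ⊤ :=
  eq_top_iff.mpr fun _ _ _ he => absurd he (Nat.not_lt_zero _)

theorem tailOrderIdeal_anti (k : ℕ) {a b : ℕ} (h : a ≤ b) :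
    tailOrderIdeal K n k b ≤ tailOrderIdeal K n k a := fun _ hf e he => hf e (he.trans_le h)

/-- Division by the variables `x_{k+1}, …, x_n`: the quotients are convergent, and their orders
are as large as they can be. -/
theorem tailOrderIdeal_inf_le {k l : ℕ} (hlk : l ≤ k) (m : ℕ) :
    tailOrderIdeal K n k 1 ⊓ tailOrderIdeal K n l (m + 1) ≤
      tailIdeal K n k * tailOrderIdeal K n l m := by
  classical
  rintro f ⟨hf, hf'⟩
  let pick : (Fin n →₀ ℕ) → Option {i : Fin n // k ≤ i.val} := fun e =>
    if h : ∃ i : {i : Fin n // k ≤ i.val}, e i.1 ≠ 0 then some h.choose else none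
  have hp : ∀ e i, pick e = some i → Finsupp.single i.1 1 ≤ e := by
    intro e i h
    simp only [pick] at h
    split_ifs at h with h'
    rw [Finsupp.single_le_iff, Nat.one_le_iff_ne_zero, ← Option.some_injective _ h]
    exact h'.choose_spec
  rw [ConvPS.eq_sum (fun i : {i : Fin n // k ≤ i.val} => Finsupp.single i.1 1) pick hp f]
  refine Ideal.add_mem _ (Ideal.sum_mem _ fun i _ => ?_) ?_
  · refine Ideal.mul_mem_mul (coord_mem_tailIdeal i.2) fun e he => ?_
    rw [coe_cdivPart, coeff_divPart]
    split_ifs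
    · refine hf' _ ?_
      rw [tailDeg_add, tailDeg_single (hlk.trans i.2)]
      omega
    · rfl
  · convert Ideal.zero_mem _
    apply Subtype.ext
    ext e
    change MvPowerSeries.coeff e (divPart 0 _ f.1) = 0
    rw [coeff_divPart]
    split_ifs with h
    · rw [add_zero] at h ⊢
      refine hf e (Nat.lt_one_iff.mpr (tailDeg_eq_zero.mpr fun i hi => ?_))
      by_contra hne
      have h' : ∃ i : {i : Fin n // k ≤ i.val}, e i.1 ≠ 0 := ⟨⟨i, hi⟩, hne⟩
      simp only [pick, Set.mem_ofPred_eq, dif_pos h', reduceCtorEq] at h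
    · rfl

/-- A series lies in `(x_{k+1}, …, x_n)^m` exactly when all its terms have degree at least `m` in
these variables. -/
theorem tailIdeal_pow_eq (k m : ℕ) : tailIdeal K n k ^ m = tailOrderIdeal K n k m := by
  have h1 : tailIdeal K n k ≤ tailOrderIdeal K n k 1 := by
    rw [tailIdeal, Ideal.span_le]
    rintro _ ⟨i, hi, rfl⟩
    have := mon_mem_tailOrderIdeal (K := K) k (Finsupp.single i 1)
    rwa [tailDeg_single hi, mon_single_one] at this
  induction m with
  | zero => rw [pow_zero, tailOrderIdeal_zero, Ideal.one_eq_top]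
  | succ m ih =>
    rw [pow_succ', ih]
    refine le_antisymm ?_ ?_
    · rw [add_comm]
      exact (Ideal.mul_mono_left h1).trans (tailOrderIdeal_mul_le k 1 m)
    · exact (le_inf (tailOrderIdeal_anti k (by omega)) le_rfl).trans
        (tailOrderIdeal_inf_le le_rfl m)

theorem tailIdeal_eq (k : ℕ) : tailIdeal K n k = tailOrderIdeal K n k 1 := by
  rw [← tailIdeal_pow_eq, pow_one]

theorem mem_maximalIdeal_iff (f : ConvPS K n) :
    f ∈ IsLocalRing.maximalIdeal (ConvPS K n) ↔ MvPowerSeries.constantCoeff f.1 = 0 := by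
  rw [IsLocalRing.mem_maximalIdeal, mem_nonunits_iff, not_iff_comm]
  constructor
  · intro h
    exact IsUnit.of_mul_eq_one ⟨f.1⁻¹, IsConvergent.inv f.2⟩
      (Subtype.ext (MvPowerSeries.mul_inv_cancel f.1 h))
  · intro h
    have := h.map (MvPowerSeries.constantCoeff.comp (convergentSubalgebra K n).val.toRingHom)
    exact this.ne_zero

theorem maximalIdeal_eq :
    IsLocalRing.maximalIdeal (ConvPS K n) = tailIdeal K n 0 := by
  ext f
  rw [mem_maximalIdeal_iff, tailIdeal_eq, mem_tailOrderIdeal]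
  constructor
  · intro h e he
    rw [tailDeg_zero_left, Nat.lt_one_iff, Finsupp.degree_eq_zero_iff] at he
    subst he
    simpa using h
  · intro h
    have := h 0 (by simp [tailDeg])
    simpa using this

theorem tailIdeal_anti {k l : ℕ} (h : k ≤ l) : tailIdeal K n l ≤ tailIdeal K n k :=
  Ideal.span_mono fun _ ⟨i, hi, hf⟩ => ⟨i, h.trans hi, hf⟩

theorem tailIdeal_le_maximalIdeal (k : ℕ) :
    tailIdeal K n k ≤ IsLocalRing.maximalIdeal (ConvPS K n) := by
  rw [maximalIdeal_eq]
  exact tailIdeal_anti (Nat.zero_le k)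

/-- The exponents of degree `m` in the variables `x_{k+1}, …, x_n` alone. -/
def tailExps (n k m : ℕ) : Finset (Fin n →₀ ℕ) :=
  (Finset.univ.filter fun i : Fin n => k ≤ i.val).finsuppAntidiag m

theorem mem_tailExps {k m : ℕ} {e : Fin n →₀ ℕ} :
    e ∈ tailExps n k m ↔ tailDeg k e = m ∧ ∀ i : Fin n, i.val < k → e i = 0 := by
  rw [tailExps, Finset.mem_finsuppAntidiag, Finset.sum_filter, tailDeg]
  refine and_congr Iff.rfl ⟨fun h i hi => ?_, fun h i hi => ?_⟩
  · by_contra hne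
    have := h (Finsupp.mem_support_iff.mpr hne)
    simp only [Finset.mem_filter, Finset.mem_univ, true_and] at this
    omega
  · simp only [Finset.mem_filter, Finset.mem_univ, true_and]
    exact not_lt.mp fun h' => (Finsupp.mem_support_iff.mp hi) (h i h')

theorem tailExps_add {k a b : ℕ} {d e : Fin n →₀ ℕ} (hd : d ∈ tailExps n k a)
    (he : e ∈ tailExps n k b) : d + e ∈ tailExps n k (a + b) := by
  rw [mem_tailExps] at *
  refine ⟨by rw [tailDeg_add, hd.1, he.1], fun i hi => by simp [hd.2 i hi, he.2 i hi]⟩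

theorem single_mem_tailExps {k : ℕ} {i : Fin n} (hi : k ≤ i.val) (p : ℕ) :
    Finsupp.single i p ∈ tailExps n k p := by
  classical
  rw [mem_tailExps]
  refine ⟨tailDeg_single hi p, fun j hj => ?_⟩
  rw [Finsupp.single_apply, if_neg]
  rintro rfl; omega

theorem tailIdeal_pow_eq_span (k m : ℕ) :
    tailIdeal K n k ^ m = Ideal.span (Set.range fun ν : tailExps n k m => mon K ν.1) := by
  classical
  apply le_antisymm
  · induction m with
    | zero =>
      rw [pow_zero, Ideal.one_eq_top, top_le_iff, Ideal.eq_top_iff_one]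
      refine Ideal.subset_span ⟨⟨0, ?_⟩, rfl⟩
      rw [mem_tailExps]
      simp [tailDeg]
    | succ m ih =>
      rw [pow_succ]
      refine (Ideal.mul_mono_left ih).trans ?_
      rw [tailIdeal, Ideal.span_mul_span', Ideal.span_le]
      rintro _ ⟨_, ⟨ν, rfl⟩, _, ⟨i, hi, rfl⟩, rfl⟩
      refine Ideal.subset_span ⟨⟨ν.1 + Finsupp.single i 1,
        tailExps_add ν.2 (single_mem_tailExps hi 1)⟩, ?_⟩
      simp only [mon_add, mon_single_one]
  · rw [Ideal.span_le, tailIdeal_pow_eq]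
    rintro _ ⟨⟨ν, hν⟩, rfl⟩
    obtain ⟨rfl, -⟩ := mem_tailExps.mp hν
    exact mon_mem_tailOrderIdeal k ν

/-- Elements of `I · (x_{k+1}, …, x_n)^m` are combinations of monomials with coefficients
in `I`. -/
theorem mem_mul_tailIdeal_pow {k m : ℕ} {I : Ideal (ConvPS K n)} {f : ConvPS K n} :
    f ∈ I * tailIdeal K n k ^ m ↔
      ∃ g : (Fin n →₀ ℕ) → ConvPS K n, (∀ ν, g ν ∈ I) ∧
        f = ∑ ν ∈ tailExps n k m, mon K ν * g ν := by
  classical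
  constructor
  · intro h
    rw [tailIdeal_pow_eq_span] at h
    obtain ⟨a, ha, hf⟩ := (Submodule.mem_ideal_smul_span_iff_exists_sum I
      (fun ν : tailExps n k m => mon K ν.1) f).mp h
    refine ⟨Function.extend Subtype.val a 0, fun ν => ?_, ?_⟩
    · by_cases h : ∃ x : tailExps n k m, x.1 = ν
      · obtain ⟨x, rfl⟩ := h
        rw [Subtype.val_injective.extend_apply]
        exact ha x
      · rw [Function.extend_apply' _ _ _ h]
        exact zero_mem _
    · rw [← Finset.sum_coe_sort]
      refine Eq.trans ?_ (Finset.sum_congr rfl fun ν _ => by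
        rw [Subtype.val_injective.extend_apply])
      rw [← Finset.sum_subset (Finset.subset_univ a.support) fun i _ hi => by
        rw [Finsupp.notMem_support_iff.mp hi, mul_zero]]
      refine hf.symm.trans (Finset.sum_congr rfl fun i _ => ?_)
      exact mul_comm _ _
  · rintro ⟨g, hg, rfl⟩
    refine Ideal.sum_mem _ fun ν hν => ?_
    rw [mul_comm (mon K ν)]
    refine Ideal.mul_mem_mul (hg ν) ?_
    rw [tailIdeal_pow_eq_span]
    exact Ideal.subset_span ⟨⟨ν, hν⟩, rfl⟩

theorem mem_tailIdeal_pow {k m : ℕ} {f : ConvPS K n} :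
    f ∈ tailIdeal K n k ^ m ↔
      ∃ g : (Fin n →₀ ℕ) → ConvPS K n, f = ∑ ν ∈ tailExps n k m, mon K ν * g ν := by
  have := mem_mul_tailIdeal_pow (I := (⊤ : Ideal (ConvPS K n))) (k := k) (m := m) (f := f)
  rw [Ideal.top_mul] at this
  simpa using this

theorem mon_mem_tailIdeal_pow {k m : ℕ} {ν : Fin n →₀ ℕ} (hν : ν ∈ tailExps n k m) :
    mon K ν ∈ tailIdeal K n k ^ m := by
  rw [tailIdeal_pow_eq_span]
  exact Ideal.subset_span ⟨⟨ν, hν⟩, rfl⟩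

/-- Quasi-regularity of the variables: the monomials of degree `m` in `x_{k+1}, …, x_n` are
linearly independent over `K{x} / (x_{k+1}, …, x_n)` modulo `(x_{k+1}, …, x_n)^{m+1}`. -/
theorem mem_tailIdeal_of_sum_mem {k m : ℕ} {g : (Fin n →₀ ℕ) → ConvPS K n}
    (h : ∑ ν ∈ tailExps n k m, mon K ν * g ν ∈ tailIdeal K n k ^ (m + 1))
    {ν : Fin n →₀ ℕ} (hν : ν ∈ tailExps n k m) : g ν ∈ tailIdeal K n k := by
  classical
  rw [tailIdeal_eq]
  intro e he
  have h1 := (tailIdeal_pow_eq k (m + 1)).le h (ν + e) (by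
    rw [tailDeg_add, (mem_tailExps.mp hν).1]; omega)
  rw [AddSubmonoidClass.coe_finsetSum, map_sum, Finset.sum_eq_single ν] at h1
  · simpa [mon, MvPowerSeries.coeff_add_monomial_mul] using h1
  · intro ν' hν' hne
    simp only [mon, Subalgebra.coe_mul]
    rw [MvPowerSeries.coeff_monomial_mul, if_neg]
    intro hle
    apply hne
    rw [mem_tailExps] at hν hν'
    have hle' : ν' ≤ ν := by
      intro i
      by_cases hi : k ≤ i.val
      · have h2 := hle i
        have h3 := tailDeg_eq_zero.mp (Nat.lt_one_iff.mp he) i hi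
        simpa [h3] using h2
      · rw [hν'.2 i (by omega)]; exact Nat.zero_le _
    obtain ⟨c, rfl⟩ := exists_add_of_le hle'
    have h4 : tailDeg k c = 0 := by
      have := hν.1
      rw [tailDeg_add, hν'.1] at this; omega
    have h5 : c = 0 := by
      ext i
      by_cases hi : k ≤ i.val
      · exact tailDeg_eq_zero.mp h4 i hi
      · have := hν.2 i (by omega)
        simp at this; simp [this.2]
    simp [h5]
  · exact fun h => (h hν).elim

end TailDegree

/-! ### Complements and dimensions of quotients -/

section LinearAlgebra

variable {K E : Type*} [Field K] [AddCommGroup E] [Module K E]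

/-- A space which has the dimension of `E / Q` and spans it is independent modulo `Q`. The
dimension enters through a second subspace `Q'` of which `U` is a complement. -/
theorem disjoint_of_rank_quotient_eq {U Q Q' : Submodule K E} [FiniteDimensional K U]
    (hU : IsCompl U Q') (hs : U ⊔ Q = ⊤)
    (hr : Module.rank K (E ⧸ Q) = Module.rank K (E ⧸ Q')) : Disjoint U Q := by
  have e : (E ⧸ Q') ≃ₗ[K] U := Submodule.quotientEquivOfIsCompl Q' U hU.symm
  have hsurj : Function.Surjective (Q.mkQ.comp U.subtype) := by
    rw [← LinearMap.range_eq_top, LinearMap.range_comp, Submodule.range_subtype,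
      Submodule.map_mkQ_eq_top]
    rwa [sup_comm] at hs
  have : FiniteDimensional K (E ⧸ Q) := Module.Finite.of_surjective _ hsurj
  have hf : Module.finrank K U = Module.finrank K (E ⧸ Q) := by
    rw [← e.finrank_eq, Module.finrank, Module.finrank, hr]
  have hinj := (LinearMap.injective_iff_surjective_of_finrank_eq_finrank hf).mpr hsurj
  rw [Submodule.disjoint_def]
  intro x hx hxQ
  have := @hinj ⟨x, hx⟩ 0 (by simpa using hxQ)
  simpa using this

theorem finrank_quotient_eq_of_inf_eq {U Q Q' : Submodule K E} (h : U ⊔ Q = ⊤) (h' : U ⊔ Q' = ⊤)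
    (hi : U ⊓ Q = U ⊓ Q') : Module.finrank K (E ⧸ Q) = Module.finrank K (E ⧸ Q') := by
  have key : ∀ Q : Submodule K E, U ⊔ Q = ⊤ →
      Module.finrank K (E ⧸ Q) = Module.finrank K (U ⧸ (U ⊓ Q).comap U.subtype) := by
    intro Q h
    have hsurj : Function.Surjective (Q.mkQ.comp U.subtype) := by
      rw [← LinearMap.range_eq_top, LinearMap.range_comp, Submodule.range_subtype,
        Submodule.map_mkQ_eq_top, sup_comm]
      exact h
    have hk : LinearMap.ker (Q.mkQ.comp U.subtype) = (U ⊓ Q).comap U.subtype := by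
      rw [LinearMap.ker_comp, Submodule.ker_mkQ]
      ext x
      simp
    rw [← hk]
    exact (LinearMap.quotKerEquivOfSurjective _ hsurj).finrank_eq.symm
  rw [key Q h, key Q' h', hi]

end LinearAlgebra

/-! ### Comparison of Hilbert-Samuel functions -/

section Tail

variable {K : Type*} [RCLike K] {n : ℕ}

/-- The local criterion of flatness for `K{x}/I` over the variables `x_{k+1}, …, x_n`: if `I` meets
the ideal of these variables in the product of the two ideals, then it does so for all powers. -/
theorem inf_tailIdeal_pow {k : ℕ} {I : Ideal (ConvPS K n)}
    (h : I ⊓ tailIdeal K n k ≤ I * tailIdeal K n k) (m : ℕ) :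
    I ⊓ tailIdeal K n k ^ m ≤ I * tailIdeal K n k ^ m := by
  induction m with
  | zero => simp
  | succ m ih =>
    rintro f ⟨hfI, hfm⟩
    obtain ⟨g, hg, rfl⟩ := mem_mul_tailIdeal_pow.mp (ih ⟨hfI, Ideal.pow_le_pow_right m.le_succ hfm⟩)
    refine Ideal.sum_mem _ fun ν hν => ?_
    have h1 : g ν ∈ I * tailIdeal K n k := h ⟨hg ν, mem_tailIdeal_of_sum_mem hfm hν⟩
    have h2 := Ideal.mul_mem_mul h1 (mon_mem_tailIdeal_pow (K := K) hν)
    rwa [mul_assoc, ← pow_succ', mul_comm (g ν)] at h2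

/-- The space `∑_{ν} x^ν B` over the monomials `x^ν` of degree `m` in `x_{k+1}, …, x_n`. -/
def tailLayer (k : ℕ) (B : Submodule K (ConvPS K n)) (m : ℕ) : Submodule K (ConvPS K n) :=
  ⨆ ν ∈ tailExps n k m, B.map (LinearMap.mulLeft K (mon K ν))

theorem mem_tailLayer {k m : ℕ} {B : Submodule K (ConvPS K n)} {f : ConvPS K n} :
    f ∈ tailLayer k B m ↔ ∃ b : (Fin n →₀ ℕ) → ConvPS K n, (∀ ν, b ν ∈ B) ∧
      f = ∑ ν ∈ tailExps n k m, mon K ν * b ν := by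
  rw [tailLayer, Submodule.mem_iSup_finset_iff_exists_sum]
  constructor
  · rintro ⟨μ, rfl⟩
    have h := fun ν => (μ ν).2
    simp only [Submodule.mem_map, LinearMap.mulLeft_apply] at h
    choose b hb hbμ using h
    exact ⟨b, hb, Finset.sum_congr rfl fun ν _ => (hbμ ν).symm⟩
  · rintro ⟨b, hb, rfl⟩
    exact ⟨fun ν => ⟨mon K ν * b ν, Submodule.mem_map.mpr ⟨b ν, hb ν, rfl⟩⟩, rfl⟩

/-- The space `∑_{ν} x^ν B` over the monomials `x^ν` of degree less than `L` in
`x_{k+1}, …, x_n`. -/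
def tailSpan (k : ℕ) (B : Submodule K (ConvPS K n)) : ℕ → Submodule K (ConvPS K n)
  | 0 => ⊥
  | L + 1 => tailSpan k B L ⊔ tailLayer k B L

instance finiteDimensional_tailSpan (k : ℕ) (B : Submodule K (ConvPS K n)) [FiniteDimensional K B]
    (L : ℕ) : FiniteDimensional K (tailSpan k B L) := by
  induction L with
  | zero => exact inferInstanceAs (FiniteDimensional K (⊥ : Submodule K (ConvPS K n)))
  | succ L ih =>
    have : FiniteDimensional K (tailLayer k B L) :=
      Submodule.finiteDimensional_finset_sup (tailExps n k L)
        (fun ν => B.map (LinearMap.mulLeft K (mon K ν))) |> fun h => by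
          rwa [Finset.sup_eq_iSup] at h
    exact Submodule.finiteDimensional_sup _ _

theorem mon_mul_mem_tailLayer {k a m : ℕ} {B : Submodule K (ConvPS K n)} {ν : Fin n →₀ ℕ}
    (hν : ν ∈ tailExps n k a) {f : ConvPS K n} (hf : f ∈ tailLayer k B m) :
    mon K ν * f ∈ tailLayer k B (m + a) := by
  obtain ⟨b, hb, rfl⟩ := mem_tailLayer.mp hf
  rw [Finset.mul_sum]
  refine Submodule.sum_mem _ fun ν' hν' => ?_
  rw [← mul_assoc, ← mon_add, add_comm ν ν']
  exact Submodule.mem_iSup_of_mem (ν' + ν) (Submodule.mem_iSup_of_mem (tailExps_add hν' hν)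
    (Submodule.mem_map.mpr ⟨b ν', hb ν', rfl⟩))

theorem mon_mul_mem_tailSpan {k a c : ℕ} {B : Submodule K (ConvPS K n)} {ν : Fin n →₀ ℕ}
    (hν : ν ∈ tailExps n k a) {f : ConvPS K n} (hf : f ∈ tailSpan k B c) :
    mon K ν * f ∈ tailSpan k B (c + a) := by
  induction c generalizing f with
  | zero =>
    rw [(Submodule.mem_bot K).mp hf, mul_zero]
    exact zero_mem _
  | succ c ih =>
    obtain ⟨u, hu, v, hv, rfl⟩ := Submodule.mem_sup.mp hf
    rw [mul_add, Nat.succ_add]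
    exact Submodule.add_mem_sup (ih hu) (mon_mul_mem_tailLayer hν hv)

/-- If `B` spans `K{x}` modulo `I + (x_{k+1}, …, x_n)`, then the products of `B` with polynomials
of degree less than `L` in `x_{k+1}, …, x_n` span it modulo `I + (x_{k+1}, …, x_n)^L`. -/
theorem exists_sub_mem_of_span {k : ℕ} {B : Submodule K (ConvPS K n)} {I : Ideal (ConvPS K n)}
    (hB : ∀ f, ∃ b ∈ B, f - b ∈ I ⊔ tailIdeal K n k) (L : ℕ) (f : ConvPS K n) :
    ∃ u ∈ tailSpan k B L, f - u ∈ I ⊔ tailIdeal K n k ^ L := by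
  induction L with
  | zero => exact ⟨0, zero_mem _, by simp⟩
  | succ L ih =>
    obtain ⟨u, hu, hfu⟩ := ih
    obtain ⟨i, hi, h, hh, hih⟩ := Submodule.mem_sup.mp hfu
    obtain ⟨g, rfl⟩ := mem_tailIdeal_pow.mp hh
    choose b hb hgb using hB
    refine ⟨u + ∑ ν ∈ tailExps n k L, mon K ν * b (g ν),
      Submodule.add_mem_sup hu (mem_tailLayer.mpr ⟨_, fun ν => hb (g ν), rfl⟩), ?_⟩
    have h1 : f - (u + ∑ ν ∈ tailExps n k L, mon K ν * b (g ν)) =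
        i + ∑ ν ∈ tailExps n k L, mon K ν * (g ν - b (g ν)) := by
      simp only [mul_sub, Finset.sum_sub_distrib]
      linear_combination -hih
    rw [h1]
    refine Ideal.add_mem _ (Ideal.mem_sup_left hi) (Ideal.sum_mem _ fun ν hν => ?_)
    have h2 := Ideal.mul_mem_mul (mon_mem_tailIdeal_pow (K := K) hν) (hgb (g ν))
    rw [Ideal.mul_sup, ← pow_succ] at h2
    have h3 : tailIdeal K n k ^ L * I ⊔ tailIdeal K n k ^ (L + 1) ≤
        I ⊔ tailIdeal K n k ^ (L + 1) := sup_le_sup_right Ideal.mul_le_right _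
    exact h3 h2

/-- If `K{x}/I` is flat over the variables `x_{k+1}, …, x_n` and `B` is independent modulo
`I + (x_{k+1}, …, x_n)`, then it is independent over the polynomials in these variables. -/
theorem eq_zero_of_mem_tailSpan {k : ℕ} {B : Submodule K (ConvPS K n)} {I : Ideal (ConvPS K n)}
    (hI : I ⊓ tailIdeal K n k ≤ I * tailIdeal K n k)
    (hB : ∀ b ∈ B, b ∈ I ⊔ tailIdeal K n k → b = 0) (L : ℕ) {u : ConvPS K n}
    (hu : u ∈ tailSpan k B L) (hu' : u ∈ I ⊔ tailIdeal K n k ^ L) : u = 0 := by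
  induction L generalizing u with
  | zero => exact (Submodule.mem_bot K).mp hu
  | succ L ih =>
    obtain ⟨v, hv, w, hw, rfl⟩ := Submodule.mem_sup.mp hu
    obtain ⟨b, hb, rfl⟩ := mem_tailLayer.mp hw
    have hwn : ∑ ν ∈ tailExps n k L, mon K ν * b ν ∈ tailIdeal K n k ^ L :=
      mem_tailIdeal_pow.mpr ⟨b, rfl⟩
    have hv0 : v = 0 := by
      refine ih hv ?_
      rw [← Ideal.add_mem_iff_left _ (Ideal.mem_sup_right hwn)]
      have h1 : I ⊔ tailIdeal K n k ^ (L + 1) ≤ I ⊔ tailIdeal K n k ^ L :=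
        sup_le_sup_left (Ideal.pow_le_pow_right L.le_succ) _
      exact h1 hu'
    subst hv0
    rw [zero_add] at hu' ⊢
    obtain ⟨i, hi, h, hh, hih⟩ := Submodule.mem_sup.mp hu'
    have hi' : i ∈ tailIdeal K n k ^ L := by
      rw [eq_sub_of_add_eq hih]
      exact Ideal.sub_mem _ hwn (Ideal.pow_le_pow_right L.le_succ hh)
    obtain ⟨g, hg, rfl⟩ := mem_mul_tailIdeal_pow.mp (inf_tailIdeal_pow hI L ⟨hi, hi'⟩)
    have h1 : ∑ ν ∈ tailExps n k L, mon K ν * (b ν - g ν) ∈ tailIdeal K n k ^ (L + 1) := by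
      simp only [mul_sub, Finset.sum_sub_distrib]
      rw [← hih, add_sub_cancel_left]
      exact hh
    refine Finset.sum_eq_zero fun ν hν => ?_
    rw [hB (b ν) (hb ν), mul_zero]
    rw [← sub_add_cancel (b ν) (g ν)]
    exact Ideal.add_mem _ (Ideal.mem_sup_right (mem_tailIdeal_of_sum_mem h1 hν))
      (Ideal.mem_sup_left (hg ν))

/-- When `K{x}/I` is free over the variables `x_{k+1}, …, x_n` with basis `B`, the trace of
`I + (x_{k+1}, …, x_n)^j J` on the polynomials in these variables with coefficients in `B` depends
only on `B` and `J`. -/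
theorem tailSpan_inf_sup {k c j : ℕ} {B : Submodule K (ConvPS K n)} {I J : Ideal (ConvPS K n)}
    (hB : ∀ f, ∃ b ∈ B, f - b ∈ I ⊔ tailIdeal K n k)
    (hfree : ∀ u ∈ tailSpan k B (c + j), u ∈ I ⊔ tailIdeal K n k ^ (c + j) → u = 0)
    (hIJ : I ≤ J) (hJ : tailIdeal K n k ^ c ≤ J) (u : ConvPS K n) :
    (u ∈ tailSpan k B (c + j) ∧ u ∈ I ⊔ J * tailIdeal K n k ^ j) ↔
      u ∈ tailLayer k (tailSpan k B c ⊓ J.restrictScalars K) j := by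
  constructor
  · rintro ⟨hu, hu'⟩
    obtain ⟨i, hi, h, hh, rfl⟩ := Submodule.mem_sup.mp hu'
    obtain ⟨g, hg, rfl⟩ := mem_mul_tailIdeal_pow.mp hh
    choose b hb hgb using exists_sub_mem_of_span hB c
    refine mem_tailLayer.mpr ⟨fun ν => b (g ν), fun ν => ⟨hb (g ν), ?_⟩, ?_⟩
    · have h1 := (sup_le hIJ hJ) (hgb (g ν))
      have h2 := J.sub_mem (hg ν) h1
      rwa [sub_sub_cancel] at h2
    · rw [← sub_eq_zero]
      apply hfree
      · refine Submodule.sub_mem _ hu (Submodule.sum_mem _ fun ν hν => ?_)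
        exact mon_mul_mem_tailSpan hν (hb (g ν))
      · rw [add_sub_assoc, ← Finset.sum_sub_distrib]
        refine Ideal.add_mem _ (Ideal.mem_sup_left hi) (Ideal.sum_mem _ fun ν hν => ?_)
        have h2 := Ideal.mul_mem_mul (hgb (g ν)) (mon_mem_tailIdeal_pow (K := K) hν)
        rw [Ideal.sup_mul, ← pow_add, mul_comm _ (mon K ν), mul_sub] at h2
        have h3 : I * tailIdeal K n k ^ j ⊔ tailIdeal K n k ^ (c + j) ≤
            I ⊔ tailIdeal K n k ^ (c + j) := sup_le_sup_right Ideal.mul_le_left _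
        exact h3 h2
  · intro hu
    obtain ⟨b, hb, rfl⟩ := mem_tailLayer.mp hu
    refine ⟨Submodule.sum_mem _ fun ν hν => mon_mul_mem_tailSpan hν (hb ν).1,
      Ideal.mem_sup_right (mem_mul_tailIdeal_pow.mpr ⟨b, fun ν => (hb ν).2, rfl⟩)⟩

local notation "𝔪" => IsLocalRing.maximalIdeal (ConvPS K n)

/-- An ideal containing a power of the maximal ideal has finite codimension. -/
theorem exists_complement (Q : Ideal (ConvPS K n)) {N : ℕ} (hQ : 𝔪 ^ N ≤ Q) :
    ∃ B : Submodule K (ConvPS K n), FiniteDimensional K B ∧ IsCompl B (Q.restrictScalars K) := by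
  obtain ⟨B, hB⟩ := Submodule.exists_isCompl (Q.restrictScalars K)
  refine ⟨B, ?_, hB.symm⟩
  have h1 : ∀ f : ConvPS K n, ∃ b ∈ Submodule.span K {(1 : ConvPS K n)},
      f - b ∈ (⊥ : Ideal (ConvPS K n)) ⊔ tailIdeal K n 0 := by
    intro f
    refine ⟨MvPowerSeries.constantCoeff f.1 • 1, Submodule.smul_mem _ _
      (Submodule.mem_span_singleton_self _), ?_⟩
    rw [bot_sup_eq, ← maximalIdeal_eq, mem_maximalIdeal_iff]
    simp
  have h2 : tailSpan 0 (Submodule.span K {(1 : ConvPS K n)}) N ⊔ Q.restrictScalars K = ⊤ := by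
    rw [eq_top_iff]
    intro f _
    obtain ⟨u, hu, hfu⟩ := exists_sub_mem_of_span h1 N f
    rw [bot_sup_eq, ← maximalIdeal_eq] at hfu
    exact Submodule.mem_sup.mpr ⟨u, hu, f - u, hQ hfu, by ring⟩
  have h3 : Function.Surjective ((Q.restrictScalars K).mkQ.comp
      (tailSpan 0 (Submodule.span K {(1 : ConvPS K n)}) N).subtype) := by
    rw [← LinearMap.range_eq_top, LinearMap.range_comp, Submodule.range_subtype,
      Submodule.map_mkQ_eq_top, sup_comm]
    exact h2
  have := Module.Finite.of_surjective _ h3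
  exact Module.Finite.equiv (Submodule.quotientEquivOfIsCompl _ _ hB)

/-- If `N` is a reduction of `𝔪` modulo `I`, the large powers of `𝔪` are given by powers of `N`. -/
theorem sup_pow_add_eq {c : ℕ} {I N : Ideal (ConvPS K n)} (hN : N ≤ 𝔪)
    (h : 𝔪 ^ (c + 1) ≤ I ⊔ N * 𝔪 ^ c) (j : ℕ) :
    I ⊔ 𝔪 ^ (c + j) = I ⊔ (I ⊔ 𝔪 ^ c) * N ^ j := by
  have h1 : 𝔪 ^ (c + j) ≤ I ⊔ 𝔪 ^ c * N ^ j := by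
    induction j with
    | zero => simp
    | succ j ih =>
      calc 𝔪 ^ (c + (j + 1)) = 𝔪 ^ (c + j) * 𝔪 := by rw [← add_assoc, pow_succ]
        _ ≤ (I ⊔ 𝔪 ^ c * N ^ j) * 𝔪 := Ideal.mul_mono_left ih
        _ = I * 𝔪 ⊔ 𝔪 ^ (c + 1) * N ^ j := by rw [Ideal.sup_mul, mul_right_comm, ← pow_succ]
        _ ≤ I ⊔ (I ⊔ N * 𝔪 ^ c) * N ^ j :=
          sup_le_sup Ideal.mul_le_left (Ideal.mul_mono_left h)
        _ ≤ I ⊔ 𝔪 ^ c * N ^ (j + 1) := by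
          rw [Ideal.sup_mul]
          refine sup_le le_sup_left (sup_le (Ideal.mul_le_left.trans le_sup_left) ?_)
          rw [pow_succ, mul_comm N, mul_assoc, mul_comm N]
          exact le_sup_right
  apply le_antisymm
  · refine sup_le le_sup_left (h1.trans (sup_le_sup_left (Ideal.mul_mono_left le_sup_right) _))
  · rw [Ideal.sup_mul]
    refine sup_le le_sup_left (sup_le (Ideal.mul_le_left.trans le_sup_left) ?_)
    rw [pow_add]
    exact (Ideal.mul_mono_right (Ideal.pow_right_mono hN j)).trans le_sup_right

theorem rank_quotient_restrictScalars (Q : Ideal (ConvPS K n)) :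
    Module.rank K (ConvPS K n ⧸ Q.restrictScalars K) = Module.rank K (ConvPS K n ⧸ Q) :=
  (Submodule.Quotient.restrictScalarsEquiv K Q).rank_eq

theorem hilbertSamuel_eq_finrank (I : Ideal (ConvPS K n)) (η : ℕ) :
    hilbertSamuel I η =
      Module.finrank K (ConvPS K n ⧸ (I ⊔ 𝔪 ^ (η + 1)).restrictScalars K) := by
  rw [hilbertSamuel, Module.finrank, Module.finrank, rank_quotient_restrictScalars]

/-- Let `(x_{k+1}, …, x_n)` be a reduction of the maximal ideal modulo both `I` and `I'`, with
reduction number at most `c`. If `I` and `I'` agree modulo `𝔪^{c+1}`, `K{x}/I'` is flat over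
`x_{k+1}, …, x_n` and the quotients by powers of these variables have the same dimensions, then the
Hilbert-Samuel functions coincide. -/
theorem hilbertSamuel_eq_of_reduction {k c : ℕ} {I I' : Ideal (ConvPS K n)}
    (h : 𝔪 ^ (c + 1) ≤ I ⊔ tailIdeal K n k * 𝔪 ^ c)
    (h' : 𝔪 ^ (c + 1) ≤ I' ⊔ tailIdeal K n k * 𝔪 ^ c)
    (hjet : I ⊔ 𝔪 ^ (c + 1) = I' ⊔ 𝔪 ^ (c + 1))
    (hflat : I' ⊓ tailIdeal K n k ≤ I' * tailIdeal K n k)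
    (hrank : ∀ m : ℕ, 1 ≤ m → Module.rank K (ConvPS K n ⧸ (I ⊔ tailIdeal K n k ^ m)) =
      Module.rank K (ConvPS K n ⧸ (I' ⊔ tailIdeal K n k ^ m))) :
    hilbertSamuel I' = hilbertSamuel I := by
  have hsup : ∀ a ≤ c + 1, I ⊔ 𝔪 ^ a = I' ⊔ 𝔪 ^ a := by
    intro a ha
    have hle := Ideal.pow_le_pow_right (I := 𝔪) ha
    rw [← sup_eq_right.mpr hle, ← sup_assoc, hjet, sup_assoc]
  funext η
  rw [hilbertSamuel_eq_finrank, hilbertSamuel_eq_finrank]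
  by_cases hη : η + 1 ≤ c
  · rw [hsup (η + 1) (by omega)]
  -- From here on both ideals are compared on the polynomials in `x_{k+1}, …, x_n` of degree less
  -- than `c + j` with coefficients in a common complement `B`.
  obtain ⟨j, hj⟩ : ∃ j, η + 1 = c + j := ⟨η + 1 - c, by omega⟩
  have hn : ∀ {I : Ideal (ConvPS K n)}, 𝔪 ^ (c + 1) ≤ I ⊔ tailIdeal K n k * 𝔪 ^ c →
      I ⊔ tailIdeal K n k = (I ⊔ 𝔪 ^ (c + 1)) ⊔ tailIdeal K n k := by
    intro I h
    refine le_antisymm (sup_le_sup_right le_sup_left _) (sup_le (sup_le le_sup_left ?_) le_sup_right)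
    exact h.trans (sup_le_sup_left Ideal.mul_le_left _)
  have hQ : I ⊔ tailIdeal K n k = I' ⊔ tailIdeal K n k := by
    rw [hn h, hn h', hjet]
  obtain ⟨B, hBf, hBc⟩ := exists_complement (I ⊔ tailIdeal K n k) (N := c + 1)
    (h.trans (sup_le_sup_left Ideal.mul_le_left _))
  have hB : ∀ f, ∃ b ∈ B, f - b ∈ I ⊔ tailIdeal K n k := by
    intro f
    obtain ⟨b, hb, q, hq, rfl⟩ := Submodule.mem_sup.mp
      (hBc.sup_eq_top.symm ▸ Submodule.mem_top (x := f))
    exact ⟨b, hb, by rwa [add_sub_cancel_left]⟩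
  have hB' : ∀ f, ∃ b ∈ B, f - b ∈ I' ⊔ tailIdeal K n k := by rwa [← hQ]
  have htop : ∀ {I : Ideal (ConvPS K n)}, (∀ f, ∃ b ∈ B, f - b ∈ I ⊔ tailIdeal K n k) → ∀ L,
      tailSpan k B L ⊔ (I ⊔ tailIdeal K n k ^ L).restrictScalars K = ⊤ := by
    intro I hB L
    rw [eq_top_iff]
    intro f _
    obtain ⟨u, hu, hfu⟩ := exists_sub_mem_of_span hB L f
    exact Submodule.mem_sup.mpr ⟨u, hu, f - u, hfu, by ring⟩
  have hfree' : ∀ u ∈ tailSpan k B (c + j), u ∈ I' ⊔ tailIdeal K n k ^ (c + j) → u = 0 := by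
    intro u hu hu'
    refine eq_zero_of_mem_tailSpan hflat (fun b hb hb' => ?_) _ hu hu'
    rw [← hQ] at hb'
    exact (Submodule.disjoint_def.mp hBc.disjoint) b hb hb'
  have hfree : ∀ u ∈ tailSpan k B (c + j), u ∈ I ⊔ tailIdeal K n k ^ (c + j) → u = 0 := by
    have hc : IsCompl (tailSpan k B (c + j))
        ((I' ⊔ tailIdeal K n k ^ (c + j)).restrictScalars K) :=
      ⟨Submodule.disjoint_def.mpr hfree', codisjoint_iff.mpr (htop hB' _)⟩
    have hd := disjoint_of_rank_quotient_eq hc (htop hB (c + j)) (by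
      rw [rank_quotient_restrictScalars, rank_quotient_restrictScalars]
      exact hrank _ (by omega))
    exact Submodule.disjoint_def.mp hd
  have hnm := tailIdeal_le_maximalIdeal (K := K) (n := n) k
  have hnc : tailIdeal K n k ^ c ≤ I ⊔ 𝔪 ^ c := (Ideal.pow_right_mono hnm c).trans le_sup_right
  have htop2 : ∀ {I : Ideal (ConvPS K n)}, (∀ f, ∃ b ∈ B, f - b ∈ I ⊔ tailIdeal K n k) →
      tailSpan k B (c + j) ⊔ (I ⊔ 𝔪 ^ (c + j)).restrictScalars K = ⊤ := by
    intro I hB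
    rw [eq_top_iff, ← htop hB (c + j)]
    have hle : I ⊔ tailIdeal K n k ^ (c + j) ≤ I ⊔ 𝔪 ^ (c + j) :=
      sup_le_sup_left (Ideal.pow_right_mono hnm _) _
    exact sup_le_sup_left (fun _ hx => hle hx) _
  rw [hj]
  refine finrank_quotient_eq_of_inf_eq (htop2 hB') (htop2 hB) ?_
  ext u
  have e := tailSpan_inf_sup hB hfree (J := I ⊔ 𝔪 ^ c) le_sup_left hnc u
  have e' := tailSpan_inf_sup hB' hfree' (J := I ⊔ 𝔪 ^ c)
    (by rw [hsup c (by omega)]; exact le_sup_left) hnc u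
  rw [← sup_pow_add_eq hnm h j] at e
  rw [hsup c (by omega), ← sup_pow_add_eq hnm h' j, ← hsup c (by omega)] at e'
  exact e'.trans e.symm

/-- Nakayama's lemma for the powers of the maximal ideal. -/
theorem pow_le_of_le_sup_pow_succ {p : ℕ} {Q : Ideal (ConvPS K n)}
    (h : 𝔪 ^ p ≤ Q ⊔ 𝔪 ^ (p + 1)) : 𝔪 ^ p ≤ Q := by
  have hfg : (𝔪 ^ p).FG := by
    rw [maximalIdeal_eq, tailIdeal_pow_eq_span]
    exact Submodule.fg_span (Set.finite_range _)
  refine Submodule.le_of_le_smul_of_le_jacobson_bot hfg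
    (IsLocalRing.maximalIdeal_le_jacobson ⊥) ?_
  rwa [smul_eq_mul, ← pow_succ']

end Tail

/-! ### Linear changes of coordinates and genericity of reductions -/

section LinearChange

variable {K : Type*} [RCLike K] {n : ℕ}

local notation "𝔪" => IsLocalRing.maximalIdeal (ConvPS K n)

theorem coe_linChange (A : Matrix (Fin n) (Fin n) K) (f : ConvPS K n) :
    (linChange A f).1 = f.1.subst (linForm A) := by
  rw [← MvPowerSeries.coe_substAlgHom (hasSubst_linForm A)]
  rfl

theorem linChange_coord (A : Matrix (Fin n) (Fin n) K) (i : Fin n) :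
    linChange A (coord i) = ∑ j, A i j • coord j := by
  apply Subtype.ext
  rw [coe_linChange, AddSubmonoidClass.coe_finsetSum]
  change MvPowerSeries.subst (linForm A) (MvPowerSeries.X i) = _
  rw [MvPowerSeries.subst_X (hasSubst_linForm A), linForm]
  refine Finset.sum_congr rfl fun j _ => ?_
  rw [← MvPowerSeries.smul_eq_C_mul]
  rfl

theorem linChange_linChange (A B : Matrix (Fin n) (Fin n) K) (f : ConvPS K n) :
    linChange B (linChange A f) = linChange (A * B) f := by
  apply Subtype.ext
  rw [coe_linChange, coe_linChange, coe_linChange,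
    MvPowerSeries.subst_comp_subst_apply (hasSubst_linForm A) (hasSubst_linForm B)]
  congr 1
  funext i
  have h : (linChange B (linChange A (coord i : ConvPS K n))) = linChange (A * B) (coord i) := by
    rw [linChange_coord, linChange_coord, map_sum]
    simp only [map_smul, linChange_coord, Finset.smul_sum, smul_smul, Matrix.mul_apply,
      Finset.sum_smul]
    exact Finset.sum_comm
  have h1 : ∀ A : Matrix (Fin n) (Fin n) K, linForm A i = (linChange A (coord i)).1 := by
    intro A
    rw [coe_linChange]
    exact (MvPowerSeries.subst_X (hasSubst_linForm A) i).symm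
  rw [h1 A, h1 (A * B), ← h, coe_linChange B]

theorem linChange_one (f : ConvPS K n) : linChange 1 f = f := by
  apply Subtype.ext
  rw [coe_linChange]
  have : linForm (1 : Matrix (Fin n) (Fin n) K) = MvPowerSeries.X := by
    funext i
    simp [linForm, Matrix.one_apply]
  rw [this, MvPowerSeries.subst_self, id]

/-- An invertible linear substitution is an automorphism of `K{x}`. -/
def linEquiv (A : GL (Fin n) K) : ConvPS K n ≃ₐ[K] ConvPS K n :=
  AlgEquiv.ofAlgHom (linChange A.val) (linChange (A⁻¹).val)
    (AlgHom.ext fun f => by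
      rw [AlgHom.comp_apply, linChange_linChange, ← Units.val_mul, inv_mul_cancel, Units.val_one,
        linChange_one, AlgHom.id_apply])
    (AlgHom.ext fun f => by
      rw [AlgHom.comp_apply, linChange_linChange, ← Units.val_mul, mul_inv_cancel, Units.val_one,
        linChange_one, AlgHom.id_apply])

theorem map_linChange_map (A B : Matrix (Fin n) (Fin n) K) (I : Ideal (ConvPS K n)) :
    (I.map (linChange A)).map (linChange B) = I.map (linChange (A * B)) := by
  have h : (linChange B).toRingHom.comp (linChange A).toRingHom = (linChange (A * B)).toRingHom :=
    RingHom.ext fun f => linChange_linChange A B f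
  change (I.map (linChange A).toRingHom).map (linChange B).toRingHom =
    I.map (linChange (A * B)).toRingHom
  rw [Ideal.map_map, h]

theorem map_linChange_one (I : Ideal (ConvPS K n)) : I.map (linChange 1) = I := by
  have h : (linChange (1 : Matrix (Fin n) (Fin n) K)).toRingHom = RingHom.id _ :=
    RingHom.ext fun f => linChange_one f
  change I.map (linChange 1).toRingHom = I
  rw [h, Ideal.map_id]

theorem map_linChange_tailIdeal (A : Matrix (Fin n) (Fin n) K) (k : ℕ) :
    (tailIdeal K n k).map (linChange A) =
      Ideal.span (Set.range fun i : {i : Fin n // k ≤ i.val} => linChange A (coord i.1)) := by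
  rw [tailIdeal, Ideal.map_span]
  congr 1
  ext f
  constructor
  · rintro ⟨_, ⟨i, hi, rfl⟩, rfl⟩
    exact ⟨⟨i, hi⟩, rfl⟩
  · rintro ⟨⟨i, hi⟩, rfl⟩
    exact ⟨_, ⟨i, hi, rfl⟩, rfl⟩

theorem linChange_coord_mem (A : Matrix (Fin n) (Fin n) K) (i : Fin n) :
    linChange A (coord i) ∈ 𝔪 := by
  rw [linChange_coord, maximalIdeal_eq]
  exact Submodule.sum_mem _ fun j _ => Submodule.smul_of_tower_mem _ _
    (coord_mem_tailIdeal (Nat.zero_le _))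

theorem map_linChange_maximalIdeal_le (A : Matrix (Fin n) (Fin n) K) :
    (𝔪).map (linChange A) ≤ 𝔪 := by
  conv_lhs => rw [maximalIdeal_eq, map_linChange_tailIdeal]
  rw [Ideal.span_le]
  rintro _ ⟨i, rfl⟩
  exact linChange_coord_mem A _

theorem map_linChange_maximalIdeal (A : GL (Fin n) K) : (𝔪).map (linChange A.val) = 𝔪 := by
  refine le_antisymm (map_linChange_maximalIdeal_le _) ?_
  have h := Ideal.map_mono (f := linChange A.val) (map_linChange_maximalIdeal_le (A⁻¹).val)
  rwa [map_linChange_map, ← Units.val_mul, inv_mul_cancel, Units.val_one, map_linChange_one] at h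

theorem map_linChange_reduction (A : GL (Fin n) K) {I N : Ideal (ConvPS K n)} {c : ℕ}
    (h : 𝔪 ^ (c + 1) ≤ I ⊔ N * 𝔪 ^ c) :
    𝔪 ^ (c + 1) ≤ I.map (linChange A.val) ⊔ N.map (linChange A.val) * 𝔪 ^ c := by
  have h1 := Ideal.map_mono (f := linChange A.val) h
  rwa [Ideal.map_sup, Ideal.map_mul, Ideal.map_pow, Ideal.map_pow,
    map_linChange_maximalIdeal] at h1

/-- Moving the change of coordinates from the ideal to the linear forms. -/
theorem reduction_map_iff (A : GL (Fin n) K) {I N : Ideal (ConvPS K n)} {c : ℕ} :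
    𝔪 ^ (c + 1) ≤ I.map (linChange A.val) ⊔ N * 𝔪 ^ c ↔
      𝔪 ^ (c + 1) ≤ I ⊔ N.map (linChange (A⁻¹).val) * 𝔪 ^ c := by
  constructor
  · intro h
    have h1 := map_linChange_reduction A⁻¹ h
    rwa [map_linChange_map, ← Units.val_mul, mul_inv_cancel, Units.val_one,
      map_linChange_one] at h1
  · intro h
    have h1 := map_linChange_reduction A h
    rwa [map_linChange_map, ← Units.val_mul, inv_mul_cancel, Units.val_one,
      map_linChange_one] at h1

theorem map_linChange_smul {a : K} (ha : a ≠ 0) (C : Matrix (Fin n) (Fin n) K) (k : ℕ) :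
    (tailIdeal K n k).map (linChange (a • C)) = (tailIdeal K n k).map (linChange C) := by
  have h1 : ∀ (a : K) (C : Matrix (Fin n) (Fin n) K),
      (tailIdeal K n k).map (linChange (a • C)) ≤ (tailIdeal K n k).map (linChange C) := by
    intro a C
    rw [map_linChange_tailIdeal, map_linChange_tailIdeal, Ideal.span_le]
    rintro _ ⟨i, rfl⟩
    have : linChange (a • C) (coord i.1 : ConvPS K n) = a • linChange C (coord i.1) := by
      simp [linChange_coord, Finset.smul_sum, smul_smul]
    change linChange (a • C) (coord i.1 : ConvPS K n) ∈ _
    rw [this]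
    exact Submodule.smul_of_tower_mem _ _ (Ideal.subset_span ⟨i, rfl⟩)
  refine le_antisymm (h1 a C) ?_
  have h2 := h1 a⁻¹ (a • C)
  rwa [smul_smul, inv_mul_cancel₀ ha, one_smul] at h2

/-- Elements of `𝔪^q` generating an ideal span it over `K` up to terms in `𝔪^{q+1}`. -/
theorem exists_mem_span_sub_mem {S : Set (ConvPS K n)} {q : ℕ} (hS : S ⊆ (𝔪 ^ q : Ideal _))
    {f : ConvPS K n} (hf : f ∈ Ideal.span S) :
    ∃ g ∈ Submodule.span K S, f - g ∈ 𝔪 ^ (q + 1) := by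
  induction hf using Submodule.span_induction with
  | mem x hx => exact ⟨x, Submodule.subset_span hx, by simp⟩
  | zero => exact ⟨0, zero_mem _, by simp⟩
  | add x y _ _ hx hy =>
    obtain ⟨g, hg, hxg⟩ := hx
    obtain ⟨h, hh, hyh⟩ := hy
    exact ⟨g + h, add_mem hg hh, by rw [add_sub_add_comm]; exact add_mem hxg hyh⟩
  | smul a x hx ih =>
    obtain ⟨g, hg, hxg⟩ := ih
    have hx' : x ∈ 𝔪 ^ q := (Ideal.span_le.mpr hS) hx
    set r : K := MvPowerSeries.constantCoeff a.1 with hr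
    refine ⟨r • g, Submodule.smul_mem _ _ hg, ?_⟩
    have ha : a - algebraMap K _ r ∈ 𝔪 := by
      rw [mem_maximalIdeal_iff]
      change MvPowerSeries.constantCoeff (a.1 - MvPowerSeries.C r) = 0
      simp [hr]
    have h1 : a • x - r • g = (a - algebraMap K _ r) * x + algebraMap K _ r * (x - g) := by
      rw [smul_eq_mul, Algebra.smul_def]; ring
    rw [h1]
    refine add_mem ?_ (Ideal.mul_mem_left _ _ hxg)
    rw [pow_succ']
    exact Ideal.mul_mem_mul ha hx'

set_option maxHeartbeats 800000 in
/-- That the linear forms with coefficient matrix `C` span a reduction of the maximal ideal of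
`K{x}/I` of a given reduction number is a Zariski open condition on `C`. -/
theorem exists_polynomial_of_reduction {I : Ideal (ConvPS K n)} {k c : ℕ}
    {C₀ : Matrix (Fin n) (Fin n) K}
    (h : 𝔪 ^ (c + 1) ≤ I ⊔ (tailIdeal K n k).map (linChange C₀) * 𝔪 ^ c) :
    ∃ P : MvPolynomial (Fin n × Fin n) K,
      MvPolynomial.eval (fun ij => C₀ ij.1 ij.2) P ≠ 0 ∧
      ∀ C : Matrix (Fin n) (Fin n) K, MvPolynomial.eval (fun ij => C ij.1 ij.2) P ≠ 0 →
        𝔪 ^ (c + 1) ≤ I ⊔ (tailIdeal K n k).map (linChange C) * 𝔪 ^ c := by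
  classical
  let Q : Submodule K (ConvPS K n) := (I ⊔ 𝔪 ^ (c + 2)).restrictScalars K
  let W : Submodule K (ConvPS K n ⧸ Q) := ((𝔪 ^ (c + 1)).restrictScalars K).map Q.mkQ
  obtain ⟨D, hDf, hDc⟩ := exists_complement (I ⊔ 𝔪 ^ (c + 2)) (N := c + 2) le_sup_right
  have : FiniteDimensional K (ConvPS K n ⧸ Q) :=
    Module.Finite.equiv (Submodule.quotientEquivOfIsCompl Q D hDc.symm).symm
  let b := Module.finBasis K W
  let ι := {i : Fin n // k ≤ i.val} × tailExps n 0 c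
  have hmon : ∀ β : tailExps n 0 c, mon K β.1 ∈ 𝔪 ^ c := fun β => by
    rw [maximalIdeal_eq]; exact mon_mem_tailIdeal_pow β.2
  have hu : ∀ (j : Fin n) (β : tailExps n 0 c), Q.mkQ (coord j * mon K β.1) ∈ W := by
    intro j β
    refine Submodule.mem_map_of_mem ?_
    rw [Submodule.restrictScalars_mem, pow_succ']
    refine Ideal.mul_mem_mul ?_ (hmon β)
    rw [maximalIdeal_eq]; exact coord_mem_tailIdeal (Nat.zero_le _)
  let u : Fin n → tailExps n 0 c → W := fun j β => ⟨_, hu j β⟩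
  let v : Matrix (Fin n) (Fin n) K → ι → W := fun C s => ∑ j, C s.1.1 j • u j s.2
  have hv : ∀ C s, ((v C s : W) : ConvPS K n ⧸ Q) =
      Q.mkQ (linChange C (coord s.1.1) * mon K s.2.1) := by
    intro C s
    simp only [v, u, linChange_coord, Finset.sum_mul, map_sum, smul_mul_assoc, map_smul,
      AddSubmonoidClass.coe_finsetSum, Submodule.coe_smul]
  -- The products of the linear forms with the monomials of degree `c` generate the ideal.
  have hgen : ∀ C : Matrix (Fin n) (Fin n) K, (tailIdeal K n k).map (linChange C) * 𝔪 ^ c =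
      Ideal.span (Set.range fun s : ι => linChange C (coord s.1.1) * mon K s.2.1) := by
    intro C
    rw [map_linChange_tailIdeal, maximalIdeal_eq, tailIdeal_pow_eq_span, Ideal.span_mul_span']
    congr 1
    ext f
    constructor
    · rintro ⟨_, ⟨i, rfl⟩, _, ⟨β, rfl⟩, rfl⟩
      exact ⟨(i, β), rfl⟩
    · rintro ⟨⟨i, β⟩, rfl⟩
      exact ⟨_, ⟨i, rfl⟩, _, ⟨β, rfl⟩, rfl⟩
  have hspan : ∀ t, b t ∈ Submodule.span K (Set.range (v C₀)) := by
    intro t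
    obtain ⟨f, hf, hft⟩ := Submodule.mem_map.mp (b t).2
    obtain ⟨i, hi, g, hg, rfl⟩ := Submodule.mem_sup.mp (h hf)
    rw [hgen C₀] at hg
    obtain ⟨g', hg', hgg'⟩ := exists_mem_span_sub_mem (q := c + 1) (by
      rintro _ ⟨s, rfl⟩
      rw [pow_succ']
      exact Ideal.mul_mem_mul (linChange_coord_mem _ _) (hmon s.2)) hg
    have h1 : ((b t : W) : ConvPS K n ⧸ Q) = Q.mkQ g' := by
      rw [← hft, ← sub_eq_zero, ← map_sub, Submodule.mkQ_apply, Submodule.Quotient.mk_eq_zero]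
      rw [add_sub_assoc]
      exact add_mem (Ideal.mem_sup_left hi) (Ideal.mem_sup_right hgg')
    have h2 : ∀ x ∈ Submodule.span K
        (Set.range fun s : ι => linChange C₀ (coord s.1.1) * mon K s.2.1),
        ∃ w ∈ Submodule.span K (Set.range (v C₀)), (w : ConvPS K n ⧸ Q) = Q.mkQ x := by
      intro x hx
      induction hx using Submodule.span_induction with
      | mem x hx =>
        obtain ⟨s, rfl⟩ := hx
        exact ⟨v C₀ s, Submodule.subset_span ⟨s, rfl⟩, hv C₀ s⟩
      | zero => exact ⟨0, zero_mem _, by simp⟩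
      | add x y _ _ hx hy =>
        obtain ⟨w, hw, hwx⟩ := hx
        obtain ⟨z, hz, hzy⟩ := hy
        exact ⟨w + z, add_mem hw hz, by rw [Submodule.coe_add, hwx, hzy, map_add]⟩
      | smul r x _ hx =>
        obtain ⟨w, hw, hwx⟩ := hx
        exact ⟨r • w, Submodule.smul_mem _ _ hw, by rw [Submodule.coe_smul, hwx, map_smul]⟩
    obtain ⟨w, hw, hwt⟩ := h2 g' hg'
    rw [← h1] at hwt
    rwa [← Subtype.ext hwt]
  -- Expressing a basis of `W` by the spanning family `v C₀` gives a constant matrix `N` with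
  -- `N * a C₀ = 1`, and `det (N * a C)` is the polynomial sought.
  simp only [Submodule.mem_span_range_iff_exists_fun] at hspan
  choose N hN using hspan
  let a : Matrix (Fin n) (Fin n) K → Matrix ι (Fin (Module.finrank K W)) K :=
    fun C => Matrix.of fun s t => b.repr (v C s) t
  let aX : Matrix ι (Fin (Module.finrank K W)) (MvPolynomial (Fin n × Fin n) K) :=
    Matrix.of fun s t => ∑ j, MvPolynomial.X (s.1.1, j) * MvPolynomial.C (b.repr (u j s.2) t)
  let N' : Matrix (Fin (Module.finrank K W)) ι K := Matrix.of N
  let NX : Matrix (Fin (Module.finrank K W)) ι (MvPolynomial (Fin n × Fin n) K) :=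
    N'.map MvPolynomial.C
  let PX : Matrix (Fin (Module.finrank K W)) (Fin (Module.finrank K W))
    (MvPolynomial (Fin n × Fin n) K) := NX * aX
  let R : Matrix (Fin n) (Fin n) K →
    Matrix (Fin (Module.finrank K W)) (Fin (Module.finrank K W)) K := fun C => N' * a C
  let P : MvPolynomial (Fin n × Fin n) K := PX.det
  have hP : ∀ C : Matrix (Fin n) (Fin n) K, MvPolynomial.eval (fun ij => C ij.1 ij.2) P =
      (R C).det := by
    intro C
    refine (RingHom.map_det _ _).trans ?_
    congr 1
    ext t t'
    rw [RingHom.mapMatrix_apply, Matrix.map_apply]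
    simp only [PX, R, Matrix.mul_apply, map_sum, map_mul, NX, aX, a, N', Matrix.map_apply,
      Matrix.of_apply, MvPolynomial.eval_C, MvPolynomial.eval_X, v, map_smul,
      Finsupp.finsetSum_apply, Finsupp.smul_apply, smul_eq_mul]
  have hrow : ∀ C t, ∑ s, N t s • v C s = ∑ t', R C t t' • b t' := by
    intro C t
    rw [← b.sum_repr (∑ s, N t s • v C s)]
    refine Finset.sum_congr rfl fun t' _ => ?_
    congr 1
    simp [R, N', Matrix.mul_apply, a, Finsupp.finsetSum_apply]
  refine ⟨P, ?_, fun C hC => ?_⟩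
  · have h1 : R C₀ = 1 := by
      ext t t'
      have h2 := hrow C₀ t
      rw [hN] at h2
      have h3 := congrArg (fun w => b.repr w t') h2
      simp only [map_sum, map_smul, Finsupp.finsetSum_apply, Finsupp.smul_apply,
        Module.Basis.repr_self, smul_eq_mul, Finsupp.single_apply] at h3
      simp only [mul_ite, mul_one, mul_zero, Finset.sum_ite_eq', Finset.mem_univ, if_true] at h3
      rw [← h3, Matrix.one_apply]
    rw [hP, h1, Matrix.det_one]
    exact one_ne_zero
  · rw [hP] at hC
    set M := R C with hM
    have hMinv : M⁻¹ * M = 1 := Matrix.nonsing_inv_mul _ hC.isUnit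
    have hb : ∀ t, b t = ∑ t', M⁻¹ t t' • ∑ s, N t' s • v C s := by
      intro t
      simp only [hrow C, Finset.smul_sum, smul_smul]
      rw [Finset.sum_comm]
      simp only [← Finset.sum_smul, ← hM]
      have : ∀ t', ∑ r, M⁻¹ t r * M r t' = (1 : Matrix _ _ K) t t' := by
        intro t'
        rw [← hMinv, Matrix.mul_apply]
      simp [this, Matrix.one_apply]
    have hW : ∀ w : W, w ∈ Submodule.span K (Set.range (v C)) := by
      intro w
      rw [← b.sum_repr w]
      refine Submodule.sum_mem _ fun t _ => Submodule.smul_mem _ _ ?_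
      rw [hb]
      exact Submodule.sum_mem _ fun t' _ => Submodule.smul_mem _ _
        (Submodule.sum_mem _ fun s _ => Submodule.smul_mem _ _ (Submodule.subset_span ⟨s, rfl⟩))
    apply pow_le_of_le_sup_pow_succ
    intro f hf
    have hfW : Q.mkQ f ∈ W := Submodule.mem_map_of_mem hf
    obtain ⟨d, hd⟩ := (Submodule.mem_span_range_iff_exists_fun K).mp (hW ⟨_, hfW⟩)
    have h1 := congrArg Subtype.val hd
    simp only [AddSubmonoidClass.coe_finsetSum, Submodule.coe_smul, hv, ← map_smul,
      ← map_sum] at h1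
    rw [eq_comm, ← sub_eq_zero, ← map_sub, Submodule.mkQ_apply,
      Submodule.Quotient.mk_eq_zero] at h1
    set g := ∑ s : ι, d s • (linChange C (coord s.1.1) * mon K s.2.1) with hg
    have hg' : g ∈ (tailIdeal K n k).map (linChange C) * 𝔪 ^ c := by
      rw [hgen C]
      refine Ideal.sum_mem _ fun s _ => ?_
      rw [Algebra.smul_def]
      exact Ideal.mul_mem_left _ _ (Ideal.subset_span ⟨s, rfl⟩)
    rw [← sub_add_cancel f g, sup_right_comm]
    exact add_mem (Ideal.mem_sup_left h1) (Ideal.mem_sup_right hg')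

/-- The openness of the reduction property as a genericity statement on the coordinate
change. The adjugate stands in for the inverse to keep the condition polynomial. -/
theorem exists_polynomial_of_reduction_map {I : Ideal (ConvPS K n)} {k c : ℕ}
    {A₀ : GL (Fin n) K} (h : 𝔪 ^ (c + 1) ≤ I.map (linChange A₀.val) ⊔ tailIdeal K n k * 𝔪 ^ c) :
    ∃ P : MvPolynomial (Fin n × Fin n) K, P ≠ 0 ∧
      ∀ A : GL (Fin n) K, MvPolynomial.eval (fun ij => A.val ij.1 ij.2) P ≠ 0 →
        𝔪 ^ (c + 1) ≤ I.map (linChange A.val) ⊔ tailIdeal K n k * 𝔪 ^ c := by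
  have hadj : ∀ A : GL (Fin n) K, (tailIdeal K n k).map (linChange A.val.adjugate) =
      (tailIdeal K n k).map (linChange (A⁻¹).val) := by
    intro A
    have hdet : A.val.det ≠ 0 := ((Matrix.isUnit_iff_isUnit_det _).mp A.isUnit).ne_zero
    have h1 : A.val.adjugate = A.val.det • (A⁻¹).val := by
      rw [Matrix.coe_units_inv, Matrix.inv_def, smul_smul, Ring.mul_inverse_cancel _ hdet.isUnit,
        one_smul]
    rw [h1, map_linChange_smul hdet]
  rw [reduction_map_iff, ← hadj] at h
  obtain ⟨P, hP0, hP⟩ := exists_polynomial_of_reduction h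
  have heval : ∀ A : Matrix (Fin n) (Fin n) K,
      MvPolynomial.eval (fun ij => A ij.1 ij.2) (MvPolynomial.bind₁
        (fun ij => (Matrix.mvPolynomialX (Fin n) (Fin n) K).adjugate ij.1 ij.2) P) =
      MvPolynomial.eval (fun ij => A.adjugate ij.1 ij.2) P := by
    intro A
    have h1 : (MvPolynomial.eval fun ij : Fin n × Fin n => A ij.1 ij.2).mapMatrix
        (Matrix.mvPolynomialX (Fin n) (Fin n) K) = A :=
      Matrix.mvPolynomialX_mapMatrix_eval A
    have h2 := RingHom.map_adjugate (MvPolynomial.eval fun ij : Fin n × Fin n => A ij.1 ij.2)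
      (Matrix.mvPolynomialX (Fin n) (Fin n) K)
    rw [h1] at h2
    rw [← MvPolynomial.coe_aeval_eq_eval, RingHom.coe_coe, MvPolynomial.aeval_bind₁,
      ← MvPolynomial.coe_aeval_eq_eval, RingHom.coe_coe]
    congr 1
    congr 1
    funext ij
    rw [← h2]
    rfl
  refine ⟨MvPolynomial.bind₁
    (fun ij => (Matrix.mvPolynomialX (Fin n) (Fin n) K).adjugate ij.1 ij.2) P,
    fun h0 => hP0 ?_, fun A hA => ?_⟩
  · rw [← heval, h0, map_zero]
  · rw [heval] at hA
    rw [reduction_map_iff, ← hadj]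
    exact hP _ hA

end LinearChange

/-! ### Weierstrass finiteness -/

section Weierstrass

variable {K : Type*} [RCLike K] {n : ℕ}

theorem ConvPS.eq_zero_of_mem_tailOrderIdeal {k : ℕ} {f : ConvPS K n}
    (h : ∀ J, f ∈ tailOrderIdeal K n k J) : f = 0 := by
  apply Subtype.ext
  ext e
  rw [h (tailDeg k e + 1) e (Nat.lt_succ_self _)]
  simp

/-- The equation `G = g + T G` is solved by the Neumann series of an operator `T` which is
contracting on small polydiscs. The terms of the series have increasing order in
`x_{k+1}, …, x_n`, so that it can be summed coefficientwise. -/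
theorem exists_eq_add_apply {k : ℕ} (T : ConvPS K n →ₗ[K] ConvPS K n)
    (hT : ∀ J, ∀ f ∈ tailOrderIdeal K n k J, T f ∈ tailOrderIdeal K n k (J + 1))
    (g : ConvPS K n) {w : Fin n → ℝ≥0} (hw : ∀ i, 0 < w i) (hg : polyNorm w g.1 ≠ ∞)
    (hTw : ∀ f, polyNorm w (T f).1 ≤ 2⁻¹ * polyNorm w f.1) :
    ∃ G, G = g + T G := by
  have hord : ∀ j, (T ^ j) g ∈ tailOrderIdeal K n k j := by
    intro j
    induction j with
    | zero => intro e he; omega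
    | succ j ih => rw [pow_succ']; exact hT j _ ih
  have hnorm : ∀ j, polyNorm w ((T ^ j) g).1 ≤ 2⁻¹ ^ j * polyNorm w g.1 := by
    intro j
    induction j with
    | zero => simp
    | succ j ih =>
      rw [pow_succ', pow_succ', mul_assoc]
      exact (hTw _).trans (by gcongr)
  let G₀ : MvPowerSeries (Fin n) K := fun e =>
    ∑ j ∈ Finset.range (tailDeg k e + 1), MvPowerSeries.coeff e ((T ^ j) g).1
  have hG₀ : ∀ e, MvPowerSeries.coeff e G₀ =
    ∑ j ∈ Finset.range (tailDeg k e + 1), MvPowerSeries.coeff e ((T ^ j) g).1 := fun e => rfl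
  have hconv : polyNorm w G₀ ≠ ∞ := by
    have hle : polyNorm w G₀ ≤ ∑' j : ℕ, 2⁻¹ ^ j * polyNorm w g.1 := by
      calc polyNorm w G₀ ≤ ∑' e : Fin n →₀ ℕ, ∑' j : ℕ,
            ((‖MvPowerSeries.coeff e ((T ^ j) g).1‖₊ * ∏ i, w i ^ e i : ℝ≥0) : ℝ≥0∞) := by
            refine ENNReal.tsum_le_tsum fun e => ?_
            rw [hG₀ e]
            refine le_trans ?_ (ENNReal.sum_le_tsum (Finset.range (tailDeg k e + 1)))
            rw [← ENNReal.ofNNReal_finsetSum, ← Finset.sum_mul]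
            gcongr
            exact nnnorm_sum_le _ _
        _ = ∑' j : ℕ, polyNorm w ((T ^ j) g).1 := ENNReal.tsum_comm
        _ ≤ _ := ENNReal.tsum_le_tsum hnorm
    refine ne_top_of_le_ne_top ?_ hle
    rw [ENNReal.tsum_mul_right, ENNReal.tsum_geometric, ENNReal.one_sub_inv_two, inv_inv]
    exact ENNReal.mul_ne_top ENNReal.ofNat_ne_top hg
  let G : ConvPS K n := ⟨G₀, IsConvergent.of_polyNorm hw hconv⟩
  have hpart : ∀ J, G - ∑ j ∈ Finset.range J, (T ^ j) g ∈ tailOrderIdeal K n k J := by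
    intro J e he
    rw [AddSubgroupClass.coe_sub, map_sub, AddSubmonoidClass.coe_finsetSum, map_sum, hG₀ e,
      sub_eq_zero]
    refine Finset.sum_subset (Finset.range_mono he) fun j _ hj => ?_
    exact hord j e (by simpa using hj)
  refine ⟨G, ?_⟩
  rw [← sub_eq_zero]
  refine ConvPS.eq_zero_of_mem_tailOrderIdeal (k := k) fun J => ?_
  have h1 : G - (g + T G) = (G - ∑ j ∈ Finset.range (J + 1), (T ^ j) g) -
      T (G - ∑ j ∈ Finset.range J, (T ^ j) g) := by
    rw [map_sub, map_sum, Finset.sum_range_succ', pow_zero]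
    simp only [pow_succ', Module.End.mul_apply, Module.End.one_apply]
    ring
  rw [h1]
  have hmono := tailOrderIdeal_anti (K := K) (n := n) k J.le_succ
  exact Ideal.sub_mem _ (hmono (hpart _)) (hmono (hT J _ (hpart J)))

/-- The polyradius `r` in the first `k` variables and `ε r` in the others. -/
def splitRadius (n k : ℕ) (r ε : ℝ≥0) (i : Fin n) : ℝ≥0 := if k ≤ i.val then ε * r else r

theorem prod_splitRadius (k : ℕ) (r ε : ℝ≥0) (e : Fin n →₀ ℕ) :
    ∏ i, splitRadius n k r ε i ^ e i = ε ^ tailDeg k e * r ^ Finsupp.degree e := by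
  rw [tailDeg, Finsupp.degree_eq_sum, ← Finset.prod_pow_eq_pow_sum, ← Finset.prod_pow_eq_pow_sum,
    ← Finset.prod_mul_distrib]
  refine Finset.prod_congr rfl fun i _ => ?_
  rw [splitRadius]
  split_ifs <;> simp [mul_pow]

theorem polyNorm_splitRadius_le {k : ℕ} {r ε : ℝ≥0} (hε : ε ≤ 1) {f : ConvPS K n}
    (hf : f ∈ tailIdeal K n k) : polyNorm (splitRadius n k r ε) f.1 ≤ ε * wnorm r f.1 := by
  rw [tailIdeal_eq] at hf
  unfold polyNorm wnorm
  rw [← ENNReal.tsum_mul_left]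
  refine ENNReal.tsum_le_tsum fun e => ?_
  rw [← ENNReal.coe_mul, ENNReal.coe_le_coe, prod_splitRadius]
  by_cases he : tailDeg k e = 0
  · rw [hf e (by omega)]
    simp
  · have : ε ^ tailDeg k e ≤ ε := pow_le_of_le_one zero_le hε he
    calc ‖MvPowerSeries.coeff e f.1‖₊ * (ε ^ tailDeg k e * r ^ Finsupp.degree e)
        = ε ^ tailDeg k e * (‖MvPowerSeries.coeff e f.1‖₊ * r ^ Finsupp.degree e) := by ring
      _ ≤ _ := by gcongr

theorem exists_common_radius {ι : Type*} [Finite ι] (f : ι → ConvPS K n) :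
    ∃ r : ℝ≥0, 0 < r ∧ ∀ i, wnorm r (f i).1 ≠ ∞ := by
  have h := fun i => isConvergent_iff.mp (f i).2
  choose r hr hf using h
  by_cases hι : Nonempty ι
  · obtain ⟨i, hi⟩ := Finite.exists_min r
    exact ⟨r i, hr i, fun j => ne_top_of_le_ne_top (hf j) (wnorm_mono (hi j) _)⟩
  · exact ⟨1, one_pos, fun i => (hι ⟨i⟩).elim⟩

/-- Division by elements of the form `x_i^p - h_i`, `i ≤ k`, with `h_i ∈ (x_{k+1}, …, x_n)`: the
remainder is a polynomial of degree less than `p` in each of the `x_i`. -/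
theorem exists_division {k p : ℕ} (h : {i : Fin n // i.val < k} → ConvPS K n)
    (hh : ∀ i, h i ∈ tailIdeal K n k) (g : ConvPS K n) :
    ∃ (q : {i : Fin n // i.val < k} → ConvPS K n) (R : ConvPS K n),
      g = ∑ i, (coord i.1 ^ p - h i) * q i + R ∧
      ∀ e, (∃ i : Fin n, i.val < k ∧ p ≤ e i) → MvPowerSeries.coeff e R.1 = 0 := by
  classical
  let ι := {i : Fin n // i.val < k}
  let β : ι → Fin n →₀ ℕ := fun i => Finsupp.single i.1 p
  let pick : (Fin n →₀ ℕ) → Option ι := fun e =>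
    if h : ∃ i : ι, p ≤ e i.1 then some h.choose else none
  have hp : ∀ e i, pick e = some i → β i ≤ e := by
    intro e i h
    simp only [pick] at h
    split_ifs at h with h'
    rw [Finsupp.single_le_iff, ← Option.some_injective _ h]
    exact h'.choose_spec
  let T : ConvPS K n →ₗ[K] ConvPS K n :=
    ∑ i, (LinearMap.mulLeft K (h i)).comp (cdivPart (β i) {e | pick e = some i})
  have hTapp : ∀ f, T f = ∑ i, h i * cdivPart (β i) {e | pick e = some i} f := by
    intro f
    simp [T, LinearMap.sum_apply]
  have hT : ∀ J, ∀ f ∈ tailOrderIdeal K n k J, T f ∈ tailOrderIdeal K n k (J + 1) := by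
    intro J f hf
    rw [hTapp]
    refine Ideal.sum_mem _ fun i _ => ?_
    rw [add_comm]
    refine tailOrderIdeal_mul_le k 1 J (Ideal.mul_mem_mul ?_ fun e he => ?_)
    · rw [← tailIdeal_eq]; exact hh i
    · rw [coe_cdivPart, coeff_divPart]
      split_ifs
      · refine hf _ ?_
        have : tailDeg k (β i) = 0 := by
          rw [tailDeg_eq_zero]
          intro j hj
          refine Finsupp.single_eq_of_ne ?_
          rintro rfl
          exact absurd i.2 (by omega)
        rw [tailDeg_add, this]; omega
      · rfl
  obtain ⟨r, hr, hrf⟩ := exists_common_radius (fun o : Option ι => o.elim g h)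
  obtain ⟨M, hM⟩ : ∃ M : ℝ≥0, (M : ℝ≥0∞) = ∑ i, wnorm r (h i).1 :=
    ⟨_, ENNReal.coe_toNNReal (ENNReal.sum_ne_top.mpr fun i _ => hrf (some i))⟩
  -- Since each `h i` involves the last variables, `T` is contracting when these have small radius.
  let ε : ℝ≥0 := min 1 (r ^ p / (2 * (M + 1)))
  have hε1 : ε ≤ 1 := min_le_left _ _
  have hε0 : 0 < ε := by positivity
  have hεM : ε * M ≤ 2⁻¹ * r ^ p := by
    calc ε * M ≤ (r ^ p / (2 * (M + 1))) * (M + 1) := by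
          gcongr
          · exact min_le_right _ _
          · simp
      _ = 2⁻¹ * r ^ p := by field_simp
  obtain ⟨G, hG⟩ := exists_eq_add_apply T hT g (w := splitRadius n k r ε)
    (fun i => by
      unfold splitRadius
      split_ifs <;> positivity)
    (ne_top_of_le_ne_top (hrf none) (by
      rw [← polyNorm_const]
      refine polyNorm_mono (fun i => ?_) _
      unfold splitRadius
      split_ifs
      · exact mul_le_of_le_one_left' hε1
      · exact le_rfl))
    (fun f => by
      have hrp : ((r ^ p : ℝ≥0) : ℝ≥0∞) ≠ 0 := by
        rw [ENNReal.coe_ne_zero]; positivity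
      rw [← ENNReal.mul_le_mul_iff_right hrp ENNReal.coe_ne_top, hTapp,
        AddSubmonoidClass.coe_finsetSum]
      calc ((r ^ p : ℝ≥0) : ℝ≥0∞) * polyNorm (splitRadius n k r ε)
            (∑ i, (h i * cdivPart (β i) {e | pick e = some i} f : ConvPS K n).1)
          ≤ ((r ^ p : ℝ≥0) : ℝ≥0∞) * ∑ i, (ε * wnorm r (h i).1) *
            polyNorm (splitRadius n k r ε) (divPart (β i) {e | pick e = some i} f.1) := by
            gcongr
            refine (polyNorm_sum _ _ _).trans (Finset.sum_le_sum fun i _ => ?_)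
            refine (polyNorm_mul _ _ _).trans ?_
            rw [coe_cdivPart]
            gcongr
            exact polyNorm_splitRadius_le hε1 (hh i)
        _ = ∑ i, (ε * wnorm r (h i).1) * (((r ^ p : ℝ≥0) : ℝ≥0∞) *
            polyNorm (splitRadius n k r ε) (divPart (β i) {e | pick e = some i} f.1)) := by
            rw [Finset.mul_sum]
            exact Finset.sum_congr rfl fun i _ => by ring
        _ ≤ ∑ i, (ε * wnorm r (h i).1) * polyNorm (splitRadius n k r ε) f.1 := by
            gcongr with i
            have h1 := polyNorm_divPart (splitRadius n k r ε) (β i) {e | pick e = some i} f.1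
            have h2 : ∏ j, splitRadius n k r ε j ^ β i j = r ^ p := by
              rw [Finset.prod_eq_single i.1]
              · simp only [β, Finsupp.single_eq_same]
                rw [splitRadius, if_neg (by have := i.2; omega)]
              · intro j _ hj
                simp [β, Finsupp.single_eq_of_ne hj]
              · simp
            rwa [h2] at h1
        _ = ((ε * M : ℝ≥0) : ℝ≥0∞) * polyNorm (splitRadius n k r ε) f.1 := by
            rw [← Finset.sum_mul, ← Finset.mul_sum, ← hM, ENNReal.coe_mul]
        _ ≤ ((2⁻¹ * r ^ p : ℝ≥0) : ℝ≥0∞) * polyNorm (splitRadius n k r ε) f.1 := by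
            gcongr
        _ = _ := by
            rw [mul_comm (2⁻¹ : ℝ≥0), ENNReal.coe_mul, mul_assoc, ENNReal.coe_inv two_ne_zero,
              ENNReal.coe_ofNat])
  refine ⟨fun i => cdivPart (β i) {e | pick e = some i} G, cdivPart 0 {e | pick e = none} G,
    ?_, ?_⟩
  · have h1 := ConvPS.eq_sum β pick hp G
    have h2 := hTapp G
    simp only [sub_mul, Finset.sum_sub_distrib]
    rw [← h2]
    simp only [β, mon_single] at h1
    linear_combination h1 - hG
  · rintro e ⟨i, hi, hpe⟩
    rw [coe_cdivPart, coeff_divPart, if_neg]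
    rw [add_zero, Set.mem_ofPred_eq]
    have h' : ∃ i : ι, p ≤ e i.1 := ⟨⟨i, hi⟩, hpe⟩
    simp only [pick, dif_pos h', reduceCtorEq, not_false_eq_true]

/-- The convergent power series in the variables `x_{k+1}, …, x_n` alone. -/
def tailAlgebra (K : Type*) [RCLike K] (n k : ℕ) : Subalgebra K (ConvPS K n) where
  carrier := {f | ∀ e, (∃ i : Fin n, i.val < k ∧ e i ≠ 0) → MvPowerSeries.coeff e f.1 = 0}
  mul_mem' {f g} hf hg e he := by
    classical
    obtain ⟨i, hi, hei⟩ := he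
    rw [Subalgebra.coe_mul, MvPowerSeries.coeff_mul]
    refine Finset.sum_eq_zero fun p hp => ?_
    rw [Finset.HasAntidiagonal.mem_antidiagonal] at hp
    by_cases h : p.1 i = 0
    · rw [hg p.2 ⟨i, hi, fun h' => hei (by rw [← hp]; simp [h, h'])⟩, mul_zero]
    · rw [hf p.1 ⟨i, hi, h⟩, zero_mul]
  add_mem' {f g} hf hg e he := by simp [hf e he, hg e he]
  algebraMap_mem' a e he := by
    classical
    obtain ⟨i, hi, hei⟩ := he
    change MvPowerSeries.coeff e (MvPowerSeries.C a) = 0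
    rw [MvPowerSeries.coeff_C, if_neg]
    rintro rfl
    exact hei rfl

/-- The Weierstrass finiteness theorem: if `K{x}/(I + (x_{k+1}, …, x_n))` has finite dimension,
then `K{x}/I` is a finite module over the power series in `x_{k+1}, …, x_n`. -/
theorem finite_tailAlgebra {k p : ℕ} {I : Ideal (ConvPS K n)}
    (h : IsLocalRing.maximalIdeal (ConvPS K n) ^ p ≤ I ⊔ tailIdeal K n k) :
    Module.Finite (tailAlgebra K n k) (ConvPS K n ⧸ I) := by
  classical
  have hx : ∀ i : {i : Fin n // i.val < k}, ∃ h ∈ tailIdeal K n k,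
      (coord i.1 : ConvPS K n) ^ p - h ∈ I := by
    intro i
    have h1 : (coord i.1 : ConvPS K n) ∈ IsLocalRing.maximalIdeal (ConvPS K n) := by
      rw [maximalIdeal_eq]; exact coord_mem_tailIdeal (Nat.zero_le _)
    obtain ⟨f, hf, g, hg, hfg⟩ := Submodule.mem_sup.mp (h (Ideal.pow_mem_pow h1 p))
    exact ⟨g, hg, by rwa [← hfg, add_sub_cancel_right]⟩
  choose h hh hI using hx
  let ι := {i : Fin n // i.val < k} → Fin p
  let β : ι → Fin n →₀ ℕ := fun φ => Finsupp.equivFunOnFinite.symm fun i =>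
    if hi : i.val < k then (φ ⟨i, hi⟩).val else 0
  have hβ : ∀ φ (i : Fin n) (hi : i.val < k), β φ i = (φ ⟨i, hi⟩).val := by
    intro φ i hi
    simp [β, hi]
  let pick : (Fin n →₀ ℕ) → Option ι := fun e =>
    if h : ∀ i : {i : Fin n // i.val < k}, e i.1 < p then some fun i => ⟨e i.1, h i⟩ else none
  have hpick : ∀ e φ, pick e = some φ → ∀ (i : Fin n), i.val < k → e i = β φ i := by
    intro e φ h i hi
    simp only [pick] at h
    split_ifs at h with h'
    rw [hβ φ i hi, ← Option.some_injective _ h]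
  have hp : ∀ e φ, pick e = some φ → β φ ≤ e := by
    intro e φ h i
    by_cases hi : i.val < k
    · exact (hpick e φ h i hi).ge
    · simp [β, hi]
  refine ⟨⟨Finset.univ.image fun φ => Ideal.Quotient.mk I (mon K (β φ)), ?_⟩⟩
  rw [eq_top_iff]
  rintro g -
  obtain ⟨g, rfl⟩ := Ideal.Quotient.mk_surjective g
  obtain ⟨q, R, hg, hR⟩ := exists_division (p := p) h hh g
  -- The remainder of the division is a polynomial in `x_1, …, x_k` over `tailAlgebra K n k`.
  have h0 : cdivPart 0 {e | pick e = none} R = 0 := by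
    apply Subtype.ext
    ext e
    rw [coe_cdivPart, coeff_divPart]
    split_ifs with hne
    · rw [add_zero, Set.mem_ofPred_eq] at hne
      rw [add_zero, hR e]
      · simp
      · by_contra hcon
        push Not at hcon
        have h' : ∀ i : {i : Fin n // i.val < k}, e i.1 < p := fun i => hcon i.1 i.2
        simp only [pick, dif_pos h', reduceCtorEq] at hne
    · simp
  have hR2 := ConvPS.eq_sum β pick hp R
  rw [h0, add_zero] at hR2
  have hs : ∀ φ, cdivPart (β φ) {e | pick e = some φ} R ∈ tailAlgebra K n k := by
    rintro φ e ⟨i, hi, hei⟩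
    rw [coe_cdivPart, coeff_divPart, if_neg]
    intro hmem
    have := hpick _ _ hmem i hi
    rw [Finsupp.add_apply] at this
    omega
  have hgR : Ideal.Quotient.mk I g = ∑ φ, (⟨_, hs φ⟩ : tailAlgebra K n k) •
      Ideal.Quotient.mk I (mon K (β φ)) := by
    have h1 : ∀ φ, (⟨_, hs φ⟩ : tailAlgebra K n k) • Ideal.Quotient.mk I (mon K (β φ)) =
        Ideal.Quotient.mk I (mon K (β φ) * cdivPart (β φ) {e | pick e = some φ} R) := by
      intro φ
      rw [mul_comm]
      rfl
    simp only [h1]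
    rw [← map_sum, ← hR2, Ideal.Quotient.eq, hg, add_sub_cancel_right]
    exact Ideal.sum_mem _ fun i _ => Ideal.mul_mem_right _ _ (hI i)
  rw [hgR]
  exact Submodule.sum_mem _ fun φ _ => Submodule.smul_mem _ _
    (Submodule.subset_span (by simp))

end Weierstrass

/-! ### Lower bounds for the Krull dimension -/

section KrullDim

variable {K : Type*} [RCLike K] {n : ℕ}

local notation "𝔪" => IsLocalRing.maximalIdeal (ConvPS K n)

/-- The substitution `x_1 = ⋯ = x_l = 0`. -/
def truncHom (K : Type*) [RCLike K] (n l : ℕ) : ConvPS K n →+* ConvPS K n where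
  toFun := cdivPart 0 {e | ∀ i : Fin n, i.val < l → e i = 0}
  map_zero' := map_zero _
  map_add' := map_add _
  map_one' := by
    classical
    apply Subtype.ext
    ext e
    rw [coe_cdivPart, coeff_divPart, add_zero, OneMemClass.coe_one, MvPowerSeries.coeff_one]
    by_cases he : e = 0
    · subst he
      simp
    · simp [he]
  map_mul' f g := by
    classical
    apply Subtype.ext
    ext e
    rw [coe_cdivPart, coeff_divPart, add_zero, Subalgebra.coe_mul, Subalgebra.coe_mul,
      MvPowerSeries.coeff_mul, MvPowerSeries.coeff_mul]
    simp only [coe_cdivPart, coeff_divPart, add_zero, Set.mem_ofPred_eq]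
    split_ifs with he
    · refine Finset.sum_congr rfl fun p hp => ?_
      rw [Finset.HasAntidiagonal.mem_antidiagonal] at hp
      have h : ∀ i : Fin n, i.val < l → p.1 i = 0 ∧ p.2 i = 0 := fun i hi => by
        have := he i hi
        rw [← hp, Finsupp.add_apply] at this
        omega
      rw [if_pos fun i hi => (h i hi).1, if_pos fun i hi => (h i hi).2]
    · refine (Finset.sum_eq_zero fun p hp => ?_).symm
      rw [Finset.HasAntidiagonal.mem_antidiagonal] at hp
      by_cases h1 : ∀ i : Fin n, i.val < l → p.1 i = 0
      · have h2 : ¬ ∀ i : Fin n, i.val < l → p.2 i = 0 := fun h2 =>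
          he fun i hi => by rw [← hp, Finsupp.add_apply, h1 i hi, h2 i hi]
        rw [if_neg h2, mul_zero]
      · rw [if_neg h1, zero_mul]

theorem truncHom_eq_zero_iff {l : ℕ} {f : ConvPS K n} : truncHom K n l f = 0 ↔
    ∀ e : Fin n →₀ ℕ, (∀ i : Fin n, i.val < l → e i = 0) → MvPowerSeries.coeff e f.1 = 0 := by
  constructor
  · intro h e he
    have h1 := congrArg (fun g : ConvPS K n => MvPowerSeries.coeff e g.1) h
    change MvPowerSeries.coeff e (divPart 0 _ f.1) = MvPowerSeries.coeff e 0 at h1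
    rw [coeff_divPart, add_zero, map_zero] at h1
    split_ifs at h1 with h2
    · exact h1
    · exact (h2 he).elim
  · intro h
    apply Subtype.ext
    ext e
    change MvPowerSeries.coeff e (divPart 0 _ f.1) = MvPowerSeries.coeff e 0
    rw [coeff_divPart, add_zero, map_zero]
    split_ifs with he
    · exact h e he
    · rfl

theorem coord_mem_tailAlgebra {k : ℕ} {i : Fin n} (hi : k ≤ i.val) :
    coord i ∈ tailAlgebra K n k := by
  classical
  rintro e ⟨j, hj, hej⟩
  change MvPowerSeries.coeff e (MvPowerSeries.X i) = 0
  rw [MvPowerSeries.coeff_X, if_neg]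
  rintro rfl
  refine hej (Finsupp.single_eq_of_ne ?_)
  rintro rfl
  omega

instance : IsDomain (ConvPS K n) :=
  have : IsDomain (MvPowerSeries (Fin n) K) := NoZeroDivisors.to_isDomain _
  Function.Injective.isDomain (convergentSubalgebra K n).val.toRingHom Subtype.val_injective

/-- The prime ideal `(x_{k+1}, …, x_l)` of the ring of power series in `x_{k+1}, …, x_n`, as the
kernel of the substitution `x_1 = ⋯ = x_l = 0`. -/
def tailPrime (K : Type*) [RCLike K] (n k l : ℕ) : PrimeSpectrum (tailAlgebra K n k) :=
  ⟨RingHom.ker ((truncHom K n l).comp (tailAlgebra K n k).val.toRingHom), RingHom.ker_isPrime _⟩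

theorem tailPrime_lt {k l : ℕ} (hkl : k ≤ l) (hl : l < n) :
    tailPrime K n k l < tailPrime K n k (l + 1) := by
  classical
  refine lt_of_le_not_ge (fun f hf => ?_) fun hle => ?_
  · exact truncHom_eq_zero_iff.mpr fun e he =>
      truncHom_eq_zero_iff.mp hf e fun i hi => he i (by omega)
  · let x : tailAlgebra K n k := ⟨coord ⟨l, hl⟩, coord_mem_tailAlgebra hkl⟩
    have h1 : x ∈ (tailPrime K n k (l + 1)).asIdeal := by
      refine truncHom_eq_zero_iff.mpr fun e he => ?_
      change MvPowerSeries.coeff e (MvPowerSeries.X (⟨l, hl⟩ : Fin n)) = 0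
      rw [MvPowerSeries.coeff_X, if_neg]
      rintro rfl
      have := he ⟨l, hl⟩ (Nat.lt_succ_self l)
      simp at this
    have h2 := truncHom_eq_zero_iff.mp (hle h1) (Finsupp.single ⟨l, hl⟩ 1) (fun i hi => by
      refine Finsupp.single_eq_of_ne ?_
      rintro rfl
      exact lt_irrefl _ hi)
    change MvPowerSeries.coeff _ (MvPowerSeries.X (⟨l, hl⟩ : Fin n)) = 0 at h2
    rw [MvPowerSeries.coeff_index_single_self_X] at h2
    exact one_ne_zero h2

/-- If `K{x}/I` is finite over the power series in `x_{k+1}, …, x_n` and these embed in it, then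
its dimension is at least `n - k`. -/
theorem le_ringKrullDim_of_injective {k : ℕ} {I : Ideal (ConvPS K n)}
    [Module.Finite (tailAlgebra K n k) (ConvPS K n ⧸ I)]
    (hinj : Function.Injective (algebraMap (tailAlgebra K n k) (ConvPS K n ⧸ I))) :
    ((n - k : ℕ) : WithBot ℕ∞) ≤ ringKrullDim (ConvPS K n ⧸ I) := by
  let l : LTSeries (PrimeSpectrum (tailAlgebra K n k)) :=
    { length := n - k
      toFun := fun i => tailPrime K n k (k + i.val)
      step := fun i => tailPrime_lt (Nat.le_add_right _ _) (by
        change k + i.val < n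
        have : i.val < n - k := i.2
        omega) }
  have : Algebra.IsIntegral (tailAlgebra K n k) (ConvPS K n ⧸ I) :=
    Algebra.IsIntegral.of_finite (tailAlgebra K n k) (ConvPS K n ⧸ I)
  obtain ⟨Q, -, hQ, hQl⟩ := Ideal.exists_ideal_over_prime_of_isIntegral
    (R := tailAlgebra K n k) (S := ConvPS K n ⧸ I) l.head.asIdeal ⊥ (by
      rw [← RingHom.ker_eq_comap_bot, (RingHom.injective_iff_ker_eq_bot _).mp hinj]
      exact bot_le)
  have : Q.LiesOver l.head.asIdeal := ⟨hQl.symm⟩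
  obtain ⟨L, hL, -⟩ := Ideal.exists_ltSeries_of_hasGoingUp
    (R := tailAlgebra K n k) (S := ConvPS K n ⧸ I) l Q
  have h : (L.length : WithBot ℕ∞) ≤ ringKrullDim (ConvPS K n ⧸ I) :=
    Order.LTSeries.length_le_krullDim L
  rwa [hL] at h

end KrullDim

/-! ### Existence of a linear reduction -/

section Existence

variable {K : Type*} [RCLike K] {n : ℕ}

local notation "𝔪" => IsLocalRing.maximalIdeal (ConvPS K n)

theorem mon_mem_tailIdeal_inf {j q : ℕ} {ν : Fin n →₀ ℕ} (hν : Finsupp.degree ν = q)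
    (h : tailDeg (j + 1) ν ≠ 0) : mon K ν ∈ tailIdeal K n (j + 1) ⊓ 𝔪 ^ q := by
  refine ⟨?_, ?_⟩
  · rw [tailIdeal_eq]
    exact tailOrderIdeal_anti _ (Nat.one_le_iff_ne_zero.mpr h) (mon_mem_tailOrderIdeal _ ν)
  · rw [maximalIdeal_eq, tailIdeal_pow_eq, ← hν, ← tailDeg_zero_left]
    exact mon_mem_tailOrderIdeal _ ν

theorem tailIdeal_inf_pow_le (k q : ℕ) :
    tailIdeal K n k ⊓ 𝔪 ^ (q + 1) ≤ tailIdeal K n k * 𝔪 ^ q := by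
  have h := tailOrderIdeal_inf_le (K := K) (n := n) (Nat.zero_le k) q
  rwa [← tailIdeal_eq, ← tailIdeal_pow_eq, ← tailIdeal_pow_eq, ← maximalIdeal_eq] at h

theorem tailDeg_eq_degree {k : ℕ} {e : Fin n →₀ ℕ} (h : ∀ i : Fin n, i.val < k → e i = 0) :
    tailDeg k e = Finsupp.degree e := by
  rw [tailDeg, Finsupp.degree_eq_sum]
  refine Finset.sum_congr rfl fun i _ => ?_
  split_ifs with hi
  · rfl
  · exact (h i (by omega)).symm

/-- `(x_{j+1}, …, x_n)^q` is generated by `x_{j+1}^q` and products involving a later variable. -/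
theorem tailIdeal_pow_succ_le {j : ℕ} (hj : j < n) (q : ℕ) :
    tailIdeal K n j ^ (q + 1) ≤
      Ideal.span {coord ⟨j, hj⟩ ^ (q + 1)} ⊔ tailIdeal K n (j + 1) * 𝔪 ^ q := by
  rw [tailIdeal_pow_eq_span, Ideal.span_le]
  rintro _ ⟨⟨ν, hν⟩, rfl⟩
  rw [mem_tailExps] at hν
  obtain ⟨hν1, hν2⟩ := hν
  by_cases h : tailDeg (j + 1) ν = 0
  · have h1 : ν = Finsupp.single ⟨j, hj⟩ (q + 1) := by
      have h2 : ν = Finsupp.single ⟨j, hj⟩ (ν ⟨j, hj⟩) := by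
        ext i
        by_cases hi : i = ⟨j, hj⟩
        · subst hi; simp
        · rw [Finsupp.single_eq_of_ne hi]
          rcases lt_trichotomy i.val j with h3 | h3 | h3
          · exact hν2 i h3
          · exact (hi (Fin.ext h3)).elim
          · exact tailDeg_eq_zero.mp h i h3
      rw [h2, tailDeg_single (k := j) (i := ⟨j, hj⟩) le_rfl] at hν1
      rw [h2, hν1]
    refine Ideal.mem_sup_left ?_
    change mon K ν ∈ _
    rw [h1, mon_single]
    exact Ideal.mem_span_singleton_self _
  · refine Ideal.mem_sup_right (tailIdeal_inf_pow_le _ _ (mon_mem_tailIdeal_inf ?_ h))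
    rw [← tailDeg_eq_degree hν2, hν1]

/-- The linear change of coordinates which moves the `j`-th basis vector to `a` and fixes the
others. -/
theorem linChange_updateCol (a : Fin n → K) (j i : Fin n) :
    linChange ((1 : Matrix (Fin n) (Fin n) K).updateCol j a) (coord i) =
      a i • coord j + if i = j then 0 else coord i := by
  classical
  rw [linChange_coord, ← Finset.add_sum_erase _ _ (Finset.mem_univ j), Matrix.updateCol_self]
  congr 1
  rw [Finset.sum_congr rfl fun l hl => by
    rw [Matrix.updateCol_ne (Finset.ne_of_mem_erase hl), Matrix.one_apply, ite_smul, one_smul,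
      zero_smul]]
  rw [Finset.sum_ite_eq]
  simp only [Finset.mem_erase, Finset.mem_univ, and_true]
  split_ifs <;> simp_all

/-- Modulo the variables after the `j`-th, the change of coordinates above turns a monomial in the
`j`-th and later variables into its value at `a` times a power of the `j`-th variable. -/
theorem linChange_updateCol_mon (a : Fin n → K) (j : Fin n) {e : Fin n →₀ ℕ}
    (he : ∀ i : Fin n, i.val < j.val → e i = 0) :
    linChange ((1 : Matrix (Fin n) (Fin n) K).updateCol j a) (mon K e) -
      (∏ i, a i ^ e i) • coord j ^ Finsupp.degree e ∈ tailIdeal K n (j.val + 1) := by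
  classical
  rw [← Ideal.Quotient.eq]
  induction e using Finsupp.induction with
  | zero => simp [mon_zero]
  | single_add i b f hif hb ih =>
    have hi : j.val ≤ i.val := by
      by_contra hlt
      have := he i (by omega)
      simp [hb] at this
    have h1 : Ideal.Quotient.mk (tailIdeal K n (j.val + 1))
        (linChange ((1 : Matrix (Fin n) (Fin n) K).updateCol j a) (coord i)) =
        Ideal.Quotient.mk _ (a i • coord j) := by
      rw [Ideal.Quotient.eq, linChange_updateCol, add_sub_cancel_left]
      split_ifs with hij
      · exact zero_mem _
      · exact coord_mem_tailIdeal (Nat.lt_of_le_of_ne hi fun h => hij (Fin.ext h.symm))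
    have h2 : ∏ l, a l ^ (Finsupp.single i b + f) l = a i ^ b * ∏ l, a l ^ f l := by
      simp only [Finsupp.add_apply, pow_add, Finset.prod_mul_distrib]
      congr 1
      rw [Finset.prod_eq_single i]
      · simp
      · intro l _ hl
        simp [Finsupp.single_eq_of_ne hl]
      · simp
    rw [mon_add, map_mul, map_mul, ih fun l hl => by
      have := he l hl
      simp at this
      exact this.2, mon_single, map_pow, map_pow, h1, h2, map_add, Finsupp.degree_single, pow_add,
      ← map_pow, ← map_mul, smul_pow, smul_mul_smul_comm]

/-- If `I` contains a nonzero series in `x_{j+1}, …, x_n`, then after a linear change of coordinates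
its leading form is regular in `x_{j+1}`, and a power of `x_{j+1}` lies in
`(x_{j+2}, …, x_n) 𝔪^q` up to elements of `I` and terms of higher order. -/
theorem exists_linChange_coord_pow_mem {j : ℕ} (hj : j < n) {I : Ideal (ConvPS K n)}
    {f : ConvPS K n} (hfI : f ∈ I) (hf : f ∈ tailAlgebra K n j) (hf0 : f ≠ 0) :
    ∃ (a : Fin n → K) (q : ℕ), a ⟨j, hj⟩ ≠ 0 ∧
      coord ⟨j, hj⟩ ^ (q + 1) ∈
        I.map (linChange ((1 : Matrix (Fin n) (Fin n) K).updateCol ⟨j, hj⟩ a)) ⊔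
          tailIdeal K n (j + 1) * 𝔪 ^ q ⊔ 𝔪 ^ (q + 2) := by
  classical
  -- Multiplication by a variable excludes leading forms of degree zero.
  set g : ConvPS K n := coord ⟨j, hj⟩ * f with hg
  have hgI : g ∈ I := Ideal.mul_mem_left _ _ hfI
  have hgT : g ∈ tailAlgebra K n j := mul_mem (coord_mem_tailAlgebra le_rfl) hf
  have hx0 : (coord ⟨j, hj⟩ : ConvPS K n) ≠ 0 := by
    intro h
    have h1 := congrArg (fun u : ConvPS K n =>
      MvPowerSeries.coeff (Finsupp.single ⟨j, hj⟩ 1) u.1) h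
    change MvPowerSeries.coeff _ (MvPowerSeries.X (⟨j, hj⟩ : Fin n)) =
      MvPowerSeries.coeff _ 0 at h1
    rw [MvPowerSeries.coeff_index_single_self_X, map_zero] at h1
    exact one_ne_zero h1
  have hg0 : g ≠ 0 := mul_ne_zero hx0 hf0
  have hex : ∃ q, ∃ e : Fin n →₀ ℕ, Finsupp.degree e = q ∧ MvPowerSeries.coeff e g.1 ≠ 0 := by
    by_contra hcon
    push Not at hcon
    apply hg0
    apply Subtype.ext
    ext e
    rw [hcon _ e rfl]
    simp
  obtain ⟨e₀, he₀, hge₀⟩ := Nat.find_spec hex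
  have hmin : ∀ e : Fin n →₀ ℕ, Finsupp.degree e < Nat.find hex →
      MvPowerSeries.coeff e g.1 = 0 := by
    intro e he
    by_contra hne
    exact Nat.find_min hex he ⟨e, rfl, hne⟩
  obtain ⟨q, hq⟩ : ∃ q, Nat.find hex = q + 1 := by
    refine Nat.exists_eq_succ_of_ne_zero fun h0 => hge₀ ?_
    rw [h0, Finsupp.degree_eq_zero_iff] at he₀
    rw [he₀]
    have h1 : g ∈ 𝔪 := Ideal.mul_mem_right _ _
      (by rw [maximalIdeal_eq]; exact coord_mem_tailIdeal (Nat.zero_le _))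
    rwa [mem_maximalIdeal_iff, ← MvPowerSeries.coeff_zero_eq_constantCoeff_apply] at h1
  rw [hq] at he₀ hmin
  have hhead : ∀ e : Fin n →₀ ℕ, MvPowerSeries.coeff e g.1 ≠ 0 →
      ∀ i : Fin n, i.val < j → e i = 0 := by
    intro e he i hi
    by_contra hne
    exact he (hgT e ⟨i, hi, hne⟩)
  -- The leading form of `g`.
  let p : MvPolynomial (Fin n) K :=
    ∑ e ∈ tailExps n j (q + 1), MvPolynomial.monomial e (MvPowerSeries.coeff e g.1)
  have hp0 : p ≠ 0 := by
    intro h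
    have h1 := congrArg (MvPolynomial.coeff e₀) h
    rw [MvPolynomial.coeff_sum, MvPolynomial.coeff_zero, Finset.sum_eq_single e₀] at h1
    · rw [MvPolynomial.coeff_monomial, if_pos rfl] at h1
      exact hge₀ h1
    · intro e _ hne
      rw [MvPolynomial.coeff_monomial, if_neg hne]
    · intro hmem
      refine (hmem (mem_tailExps.mpr ⟨?_, hhead e₀ hge₀⟩)).elim
      rw [tailDeg_eq_degree (hhead e₀ hge₀), he₀]
  obtain ⟨a, ha⟩ : ∃ a : Fin n → K, MvPolynomial.eval a (p * MvPolynomial.X ⟨j, hj⟩) ≠ 0 := by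
    by_contra hcon
    push Not at hcon
    refine mul_ne_zero hp0 (MvPolynomial.X_ne_zero (R := K) (⟨j, hj⟩ : Fin n))
      (MvPolynomial.funext fun a => ?_)
    rw [hcon a, map_zero]
  rw [map_mul, MvPolynomial.eval_X] at ha
  have hpa : MvPolynomial.eval a p ≠ 0 := left_ne_zero_of_mul ha
  refine ⟨a, q, right_ne_zero_of_mul ha, ?_⟩
  set φ := linChange ((1 : Matrix (Fin n) (Fin n) K).updateCol ⟨j, hj⟩ a) with hφ
  have hφm : ∀ r, ∀ u ∈ 𝔪 ^ r, φ u ∈ 𝔪 ^ r := by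
    intro r u hu
    have h1 := Ideal.mem_map_of_mem φ hu
    rw [Ideal.map_pow] at h1
    exact Ideal.pow_right_mono (map_linChange_maximalIdeal_le _) r h1
  -- The leading form as a power series, and its image under the change of coordinates.
  set g₀ : ConvPS K n := ∑ e ∈ tailExps n j (q + 1), MvPowerSeries.coeff e g.1 • mon K e with hg₀
  have hgg₀ : g - g₀ ∈ 𝔪 ^ (q + 2) := by
    rw [maximalIdeal_eq, tailIdeal_pow_eq]
    intro e he
    rw [tailDeg_zero_left] at he
    rw [AddSubgroupClass.coe_sub, map_sub, hg₀, AddSubmonoidClass.coe_finsetSum, map_sum,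
      sub_eq_zero]
    have hterm : ∀ e' : Fin n →₀ ℕ,
        MvPowerSeries.coeff e (MvPowerSeries.coeff e' g.1 • mon K e' : ConvPS K n).1 =
          if e = e' then MvPowerSeries.coeff e' g.1 else 0 := by
      intro e'
      change MvPowerSeries.coeff e (MvPowerSeries.coeff e' g.1 • MvPowerSeries.monomial e' (1 : K))
        = _
      rw [MvPowerSeries.coeff_smul, MvPowerSeries.coeff_monomial]
      split_ifs <;> simp
    rw [Finset.sum_congr rfl fun e' _ => hterm e', Finset.sum_ite_eq]
    split_ifs with hmem
    · rfl
    · by_contra hne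
      have h1 : Finsupp.degree e = q + 1 := by
        by_contra h2
        exact hne (hmin e (by omega))
      exact hmem (mem_tailExps.mpr ⟨by rw [tailDeg_eq_degree (hhead e hne), h1], hhead e hne⟩)
  have hφg₀ : φ g₀ - MvPolynomial.eval a p • coord ⟨j, hj⟩ ^ (q + 1) ∈
      tailIdeal K n (j + 1) * 𝔪 ^ q := by
    have h1 : φ g₀ - MvPolynomial.eval a p • coord ⟨j, hj⟩ ^ (q + 1) =
        ∑ e ∈ tailExps n j (q + 1), MvPowerSeries.coeff e g.1 •
          (φ (mon K e) - (∏ i, a i ^ e i) • coord ⟨j, hj⟩ ^ (q + 1)) := by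
      have h2 : MvPolynomial.eval a p =
          ∑ e ∈ tailExps n j (q + 1), MvPowerSeries.coeff e g.1 * ∏ i, a i ^ e i := by
        rw [map_sum]
        refine Finset.sum_congr rfl fun e _ => ?_
        rw [MvPolynomial.eval_monomial, Finsupp.prod_fintype _ _ (fun i => pow_zero _)]
      rw [hg₀, map_sum, h2, Finset.sum_smul, ← Finset.sum_sub_distrib]
      refine Finset.sum_congr rfl fun e _ => ?_
      rw [map_smul, smul_sub, smul_smul]
    rw [h1]
    refine Ideal.sum_mem _ fun e he => Submodule.smul_of_tower_mem _ _ ?_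
    obtain ⟨he1, he2⟩ := mem_tailExps.mp he
    have hdeg : Finsupp.degree e = q + 1 := by rw [← tailDeg_eq_degree he2, he1]
    have hxm : ∀ i : Fin n, (coord i : ConvPS K n) ∈ 𝔪 := fun i => by
      rw [maximalIdeal_eq]; exact coord_mem_tailIdeal (Nat.zero_le _)
    refine tailIdeal_inf_pow_le _ _ ⟨?_, ?_⟩
    · have h3 := linChange_updateCol_mon a ⟨j, hj⟩ he2
      rwa [hdeg] at h3
    · refine Ideal.sub_mem _ (hφm _ _ ?_)
        (Submodule.smul_of_tower_mem _ _ (Ideal.pow_mem_pow (hxm _) _))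
      rw [maximalIdeal_eq, tailIdeal_pow_eq, ← hdeg, ← tailDeg_zero_left]
      exact mon_mem_tailOrderIdeal 0 e
  have hmem : MvPolynomial.eval a p • (coord ⟨j, hj⟩ : ConvPS K n) ^ (q + 1) ∈
      I.map φ ⊔ tailIdeal K n (j + 1) * 𝔪 ^ q ⊔ 𝔪 ^ (q + 2) := by
    have h1 : MvPolynomial.eval a p • (coord ⟨j, hj⟩ : ConvPS K n) ^ (q + 1) =
        φ g - (φ g₀ - MvPolynomial.eval a p • coord ⟨j, hj⟩ ^ (q + 1)) - φ (g - g₀) := by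
      rw [map_sub]; ring
    rw [h1]
    refine Ideal.sub_mem _ (Ideal.sub_mem _ ?_ ?_) ?_
    · exact Ideal.mem_sup_left (Ideal.mem_sup_left (Ideal.mem_map_of_mem φ hgI))
    · exact Ideal.mem_sup_left (Ideal.mem_sup_right hφg₀)
    · exact Ideal.mem_sup_right (hφm _ _ hgg₀)
  have h2 := Submodule.smul_of_tower_mem
    (I.map φ ⊔ tailIdeal K n (j + 1) * 𝔪 ^ q ⊔ 𝔪 ^ (q + 2)) (MvPolynomial.eval a p)⁻¹ hmem
  rwa [smul_smul, inv_mul_cancel₀ hpa, one_smul] at h2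

/-- One step of Noether normalization for the associated graded ring of `K{x}/I`: as long as the
power series in `x_{j+1}, …, x_n` do not embed in `K{x}/I`, one of these variables can be dropped
from the reduction. -/
theorem exists_reduction_succ {j c : ℕ} (hj : j < n) {I : Ideal (ConvPS K n)}
    (h : 𝔪 ^ (c + 1) ≤ I ⊔ tailIdeal K n j * 𝔪 ^ c)
    {f : ConvPS K n} (hfI : f ∈ I) (hf : f ∈ tailAlgebra K n j) (hf0 : f ≠ 0) :
    ∃ (B : GL (Fin n) K) (c' : ℕ),
      𝔪 ^ (c' + 1) ≤ I.map (linChange B.val) ⊔ tailIdeal K n (j + 1) * 𝔪 ^ c' := by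
  classical
  obtain ⟨a, q, ha, hx⟩ := exists_linChange_coord_pow_mem hj hfI hf hf0
  have hdet : ((1 : Matrix (Fin n) (Fin n) K).updateCol ⟨j, hj⟩ a).det ≠ 0 := by
    rw [← Matrix.cramer_apply, Matrix.cramer_one]
    exact ha
  set B : GL (Fin n) K := Matrix.GeneralLinearGroup.mkOfDetNeZero _ hdet with hB
  have hBval : B.val = (1 : Matrix (Fin n) (Fin n) K).updateCol ⟨j, hj⟩ a := rfl
  rw [← hBval] at hx
  set I' := I.map (linChange B.val) with hI'
  have htail : (tailIdeal K n j).map (linChange B.val) ≤ tailIdeal K n j := by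
    rw [map_linChange_tailIdeal, Ideal.span_le]
    rintro _ ⟨i, rfl⟩
    change linChange B.val (coord i.1) ∈ tailIdeal K n j
    rw [hBval, linChange_updateCol]
    refine Ideal.add_mem _ (Submodule.smul_of_tower_mem _ _ (coord_mem_tailIdeal le_rfl)) ?_
    split_ifs
    · exact zero_mem _
    · exact coord_mem_tailIdeal i.2
  have h1 : 𝔪 ^ (c + 1) ≤ I' ⊔ tailIdeal K n j * 𝔪 ^ c :=
    (map_linChange_reduction B h).trans (sup_le_sup_left (Ideal.mul_mono_left htail) _)
  have h2 : 𝔪 ^ (c + (q + 1)) ≤ I' ⊔ (I' ⊔ 𝔪 ^ c) * tailIdeal K n j ^ (q + 1) := by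
    rw [← sup_pow_add_eq (tailIdeal_le_maximalIdeal j) h1 (q + 1)]
    exact le_sup_right
  refine ⟨B, c + q, pow_le_of_le_sup_pow_succ ?_⟩
  have h3 : tailIdeal K n j ^ (q + 1) ≤ I' ⊔ tailIdeal K n (j + 1) * 𝔪 ^ q ⊔ 𝔪 ^ (q + 2) := by
    refine (tailIdeal_pow_succ_le hj q).trans (sup_le ?_ (le_sup_right.trans le_sup_left))
    rwa [Ideal.span_singleton_le_iff_mem]
  rw [add_assoc c q 1]
  refine h2.trans (sup_le (le_sup_left.trans le_sup_left) ?_)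
  rw [Ideal.sup_mul]
  refine sup_le (Ideal.mul_le_left.trans (le_sup_left.trans le_sup_left)) ?_
  refine (Ideal.mul_mono_right h3).trans ?_
  rw [Ideal.mul_sup, Ideal.mul_sup, mul_left_comm, ← pow_add, ← pow_add]
  exact sup_le_sup (sup_le_sup_right Ideal.mul_le_right _) le_rfl

/-- In suitable linear coordinates, `dim K{x}/I` of the variables generate a reduction of the maximal
ideal of `K{x}/I`. -/
theorem exists_reduction {k : ℕ} (hk : k ≤ n) {I : Ideal (ConvPS K n)}
    (hdim : ringKrullDim (ConvPS K n ⧸ I) = ((n - k : ℕ) : ℕ∞)) :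
    ∃ (A : GL (Fin n) K) (c : ℕ),
      𝔪 ^ (c + 1) ≤ I.map (linChange A.val) ⊔ tailIdeal K n k * 𝔪 ^ c := by
  suffices h : ∀ j ≤ k, ∃ (A : GL (Fin n) K) (c : ℕ),
      𝔪 ^ (c + 1) ≤ I.map (linChange A.val) ⊔ tailIdeal K n j * 𝔪 ^ c from h k le_rfl
  intro j
  induction j with
  | zero =>
    refine fun _ => ⟨1, 0, le_sup_of_le_right ?_⟩
    rw [← maximalIdeal_eq, pow_zero, mul_one, zero_add, pow_one]
  | succ j ih =>
    intro hj
    obtain ⟨A, c, hA⟩ := ih (by omega)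
    have hfin : Module.Finite (tailAlgebra K n j) (ConvPS K n ⧸ I.map (linChange A.val)) :=
      finite_tailAlgebra (hA.trans (sup_le_sup_left Ideal.mul_le_left _))
    have hdim' : ringKrullDim (ConvPS K n ⧸ I.map (linChange A.val)) = ((n - k : ℕ) : ℕ∞) := by
      rw [← hdim]
      exact (ringKrullDim_eq_of_ringEquiv
        (Ideal.quotientEquiv I (I.map (linChange A.val)) (linEquiv A).toRingEquiv rfl)).symm
    have hninj : ¬ Function.Injective
        (algebraMap (tailAlgebra K n j) (ConvPS K n ⧸ I.map (linChange A.val))) := by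
      intro hinj
      have h1 := le_ringKrullDim_of_injective hinj
      rw [hdim'] at h1
      have h2 : n - j ≤ n - k := Nat.cast_le.mp (WithBot.coe_le_coe.mp h1)
      omega
    obtain ⟨f, hf, hf0⟩ := Submodule.exists_mem_ne_zero_of_ne_bot fun h =>
      hninj ((RingHom.injective_iff_ker_eq_bot _).mpr h)
    obtain ⟨B, c', hB⟩ := exists_reduction_succ (by omega) hA
      (Ideal.Quotient.eq_zero_iff_mem.mp (RingHom.mem_ker.mp hf))
      f.2 (fun h0 => hf0 (Subtype.ext h0))
    refine ⟨A * B, c', ?_⟩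
    rwa [map_linChange_map, ← Units.val_mul] at hB

end Existence

end HSStability

end

theorem proposition6p7 {K : Type*} [RCLike K] {n k s : ℕ} (hk : k ≤ n)
    (F : Fin s → HSStability.ConvPS K n)
    (hdim : ringKrullDim (HSStability.ConvPS K n ⧸ Ideal.span (Set.range F)) = ((n - k : ℕ) : ℕ∞)) :
    HSStability.ForGenericLinearChange fun A : GL (Fin n) K =>
      ∃ μ₀ : ℕ, ∀ μ ≥ μ₀,
        ∀ Iμ ∈ HSStability.jetApprox μ (fun i => HSStability.linChange A.val (F i)),
          Iμ ⊓ HSStability.tailIdeal K n k = Iμ * HSStability.tailIdeal K n k →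
          (∀ m : ℕ, 1 ≤ m →
            Module.rank K (HSStability.ConvPS K n ⧸
              ((Ideal.span (Set.range F)).map (HSStability.linChange A.val) ⊔
                HSStability.tailIdeal K n k ^ m)) =
            Module.rank K (HSStability.ConvPS K n ⧸ (Iμ ⊔ HSStability.tailIdeal K n k ^ m))) →
          HSStability.hilbertSamuel Iμ =
            HSStability.hilbertSamuel
              ((Ideal.span (Set.range F)).map (HSStability.linChange A.val)) := by
  obtain ⟨A₀, c, hA₀⟩ := HSStability.exists_reduction hk hdim
  obtain ⟨P, hP0, hP⟩ := HSStability.exists_polynomial_of_reduction_map hA₀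
  refine ⟨P, hP0, fun A hA => ⟨c + 1, ?_⟩⟩
  rintro μ hμ _ ⟨G, hG, rfl⟩ hflat hrank
  have hred := hP A hA
  set I := (Ideal.span (Set.range F)).map (HSStability.linChange A.val) with hI
  have hIspan : I = Ideal.span (Set.range fun i => HSStability.linChange A.val (F i)) := by
    rw [hI, Ideal.map_span, ← Set.range_comp]
    rfl
  have hGF : ∀ i, G i - HSStability.linChange A.val (F i) ∈
      IsLocalRing.maximalIdeal (HSStability.ConvPS K n) ^ (μ + 1) :=
    fun i => Ideal.Quotient.eq.mp (hG i)
  have hle : I ≤ Ideal.span (Set.range G) ⊔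
      IsLocalRing.maximalIdeal (HSStability.ConvPS K n) ^ (μ + 1) := by
    rw [hIspan, Ideal.span_le]
    rintro _ ⟨i, rfl⟩
    have h1 := Ideal.sub_mem _ (Ideal.mem_sup_left (Ideal.subset_span ⟨i, rfl⟩) :
      G i ∈ Ideal.span (Set.range G) ⊔ _) (Ideal.mem_sup_right (hGF i))
    rwa [sub_sub_cancel] at h1
  have hge : Ideal.span (Set.range G) ≤
      I ⊔ IsLocalRing.maximalIdeal (HSStability.ConvPS K n) ^ (μ + 1) := by
    rw [hIspan, Ideal.span_le]
    rintro _ ⟨i, rfl⟩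
    have h1 := Ideal.add_mem _ (Ideal.mem_sup_right (hGF i))
      (Ideal.mem_sup_left (Ideal.subset_span ⟨i, rfl⟩) :
        HSStability.linChange A.val (F i) ∈
          Ideal.span (Set.range fun i => HSStability.linChange A.val (F i)) ⊔ _)
    rwa [sub_add_cancel] at h1
  have hpow : ∀ a ≤ μ + 1, IsLocalRing.maximalIdeal (HSStability.ConvPS K n) ^ (μ + 1) ≤
      IsLocalRing.maximalIdeal (HSStability.ConvPS K n) ^ a := fun a ha => Ideal.pow_le_pow_right ha
  refine HSStability.hilbertSamuel_eq_of_reduction hred ?_ ?_ hflat.le hrank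
  · refine HSStability.pow_le_of_le_sup_pow_succ (hred.trans (sup_le ?_ ?_))
    · exact hle.trans (sup_le_sup le_sup_left (hpow _ (by omega)))
    · exact le_sup_right.trans le_sup_left
  · exact le_antisymm
      (sup_le (hle.trans (sup_le_sup_left (hpow _ (by omega)) _)) le_sup_right)
      (sup_le (hge.trans (sup_le_sup_left (hpow _ (by omega)) _)) le_sup_right)
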